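/- All rings are commutative with $1$. A ring $B$ is called *seminormal* if it is reduced and for all $y,z\in B$ with $y^3=z^2$ there is $x\in B$ with $y=x^2$ and $z=x^3$. It is called *weakly normal* if it is seminormal and, for every prime number $p$, all $y,z,w\in B$ and every nonzerodivisor $d\in B$ with $z^p=yd^p$ and $pz=dw$, there is $x\in B$ with $y=x^p$ and $w=px$. Let $(A,\mathfrak m)$ be a Noetherian local ring with $\dim A\ge 1$, let $I\subsetneq A$ be a proper ideal, and let $t$ be an indeterminate over $A$. Put $I^n=A$ for $n\le 0$, and let $$\mathscr R_+(I)=A[It]=\bigoplus_{n\ge 0}I^nt^n\subseteq A[t],\qquad \mathscr R(I)=A[It,t^{-1}]=\bigoplus_{n\in\mathbb Z}I^nt^n\subseteq A[t,t^{-1}],$$ $$G(I)=\mathscr R_+(I)/I\mathscr R_+(I)=\bigoplus_{n\ge 0}I^n/I^{n+1}$$ be the Rees ring, the extended Rees ring and the associated graded ring of $I$. Then: 1. If $G(I)$ is seminormal, then $\mathscr R_+(I)$, $\mathscr R(I)$ and $A$ are seminormal. 2. If $G(I)$ is weakly normal, then $\mathscr R_+(I)$, $\mathscr R(I)$ and $A$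 are weakly normal. -/

import Mathlib

/-- A commutative ring is seminormal if it is reduced and every pair `y, z` with `y ^ 3 = z ^ 2` is of
the form `y = x ^ 2`, `z = x ^ 3`. -/
structure IsSeminormalRing (A : Type*) [CommRing A] : Prop where
  reduced : IsReduced A
  exists_sq_cube : ∀ y z : A, y ^ 3 = z ^ 2 → ∃ x : A, y = x ^ 2 ∧ z = x ^ 3

/-- A commutative ring is weakly normal if it is seminormal and, for every prime number `p`, all
`y, z, w` and every nonzerodivisor `d` with `z ^ p = y * d ^ p` and `p * z = d * w`, there is an `x`
with `y = x ^ p` and `w = p * x`. -/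
structure IsWeaklyNormalRing (A : Type*) [CommRing A] : Prop where
  seminormal : IsSeminormalRing A
  exists_pow_mul : ∀ p : ℕ, p.Prime → ∀ y z w d : A, d ∈ nonZeroDivisors A →
    z ^ p = y * d ^ p → (p : A) * z = d * w → ∃ x : A, y = x ^ p ∧ w = (p : A) * x

/-- The extended Rees ring `A[It, t⁻¹] = ⨁ (n : ℤ), I ^ n t ^ n` as a subalgebra of `A[t, t⁻¹]`, with the
convention `I ^ n = A` for `n ≤ 0`. -/
def extendedReesRing {A : Type*} [CommRing A] (I : Ideal A) :
    Subalgebra A (LaurentPolynomial A) where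
  carrier := {f | ∀ n : ℤ, f.coeff n ∈ I ^ n.toNat}
  mul_mem' := by
    intro f g hf hg n
    rw [AddMonoidAlgebra.coeff_mul]
    refine Ideal.sum_mem _ fun i _ => Ideal.sum_mem _ fun j _ => ?_
    dsimp only
    split_ifs with h
    · exact Ideal.pow_le_pow_right (by omega : n.toNat ≤ i.toNat + j.toNat)
        (pow_add I i.toNat j.toNat ▸ Ideal.mul_mem_mul (hf i) (hg j))
    · exact Ideal.zero_mem _
  add_mem' := fun hf hg n => Ideal.add_mem _ (hf n) (hg n)
  algebraMap_mem' := by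
    intro a n
    rw [← LaurentPolynomial.C_eq_algebraMap, LaurentPolynomial.C_apply]
    split_ifs with h
    · simp [h]
    · exact Ideal.zero_mem _

/-- The associated graded ring `G(I) = A[It] / I A[It] = ⨁ (n : ℕ), I ^ n / I ^ (n + 1)`. -/
abbrev associatedGradedRing {A : Type*} [CommRing A] (I : Ideal A) : Type _ :=
  reesAlgebra I ⧸ I.map (algebraMap A (reesAlgebra I))

/-! Write `R = A[It, t⁻¹]` and `u = t⁻¹`. Then `R` is Noetherian, `u` is a nonzerodivisor and `R /
uR` is `G(I)`, so the theorem is a deformation statement: a property passes from `R / uR` to `R`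
near `u = 0`, then to `A`, and then to both Rees rings.

Deformation (`exists_mul_mem_range_of_sq_of_cube`). Let `s` lie in the total ring of fractions `K`,
with `s²` and `s³` in `R`; the claim is `g s ∈ R` for some `g ≡ 1` mod `u`. Otherwise Noetherianity
yields such an `s` whose ideal of denominators `P` is prime. The ring `T = (P : P) ⊆ K` is finite
over `R`, contains `s`, and has `P` as an ideal. Since `R / uR` is reduced, `uτ ∈ R` with `τ ∈ T`
forces `τ ∈ R`; since it is seminormal, so is `R + uT` in `T`. Hence, with `D = R / P` and `E = T /
P`, every nilpotent of `E` lies in `D + uE`. For the nilradical `J` of `E` this embeds `J / uJ` into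
`Q / uD`, where `Q` is a minimal prime of `uD`. A nonzero functional on `J` with image `J'` would
contradict this, because `J' / uJ'` and `D / uD` have the same finite length at `Q`. So `s`,
nilpotent in `E`, is torsion over `D`: `b s ∈ R` for some `b ∉ P`, contrary to the definition of
`P`.

For weak normality (`exists_mul_mem_range_of_pow_prime`) the elements of `T` with some `p^n`-th
power in `R` form a finite module `M` with `M ⊆ R + uM`, and Nakayama's lemma produces `g`.

Descent to `A`. If `s = a / e` with `a, e ∈ A`, compare degree zero parts in `g s ∈ R`: that of `g`
is a unit because `A` is local and `I` is proper, so `e` divides `a`. This makes `A` seminormal or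
weakly normal, and the property then passes to `A[X]` and `A[t, t⁻¹]`. Finally `R` is closed under
roots in `A[t, t⁻¹]` because `R / uR` is reduced, and `A[It]` is closed under roots in `R` because
`A` is reduced. -/

/-- The length of the localization of a module at a prime ideal. -/
noncomputable def lengthAtPrime {D : Type*} [CommRing D] (Q : Ideal D) [Q.IsPrime] (X : Type*)
    [AddCommGroup X] [Module D X] : ℕ∞ :=
  Module.length (Localization Q.primeCompl) (LocalizedModule Q.primeCompl X)

/-! ### Lengths at a prime of height at most one, and torsion of nilpotents -/

section LengthAtPrime

variable {D : Type*} [CommRing D] (Q : Ideal D) [Q.IsPrime]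
  {X Y Z : Type*} [AddCommGroup X] [Module D X] [AddCommGroup Y] [Module D Y]
  [AddCommGroup Z] [Module D Z]

theorem lengthAtPrime_eq_add_of_exact (f : X →ₗ[D] Y) (g : Y →ₗ[D] Z)
    (hf : Function.Injective f) (hg : Function.Surjective g) (h : Function.Exact f g) :
    lengthAtPrime Q Y = lengthAtPrime Q X + lengthAtPrime Q Z :=
  Module.length_eq_add_of_exact (LocalizedModule.map Q.primeCompl f)
    (LocalizedModule.map Q.primeCompl g) (LocalizedModule.map_injective _ f hf)
    (LocalizedModule.map_surjective _ g hg) (LocalizedModule.map_exact _ f g h)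

theorem lengthAtPrime_le_of_surjective (g : X →ₗ[D] Y) (hg : Function.Surjective g) :
    lengthAtPrime Q Y ≤ lengthAtPrime Q X :=
  Module.length_le_of_surjective (LocalizedModule.map Q.primeCompl g)
    (LocalizedModule.map_surjective _ g hg)

theorem lengthAtPrime_quotient_pos : 0 < lengthAtPrime Q (D ⧸ Q) := by
  rw [lengthAtPrime, Module.length_pos_iff]
  refine ⟨LocalizedModule.mk 1 1, 0, fun h => ?_⟩
  rw [← LocalizedModule.zero_mk 1, LocalizedModule.mk_eq] at h
  obtain ⟨c, hc⟩ := h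
  have h2 : (Ideal.Quotient.mk Q (c : D)) = 0 := by
    simpa [Submonoid.smul_def, Algebra.smul_def] using hc
  exact c.2 (Ideal.Quotient.eq_zero_iff_mem.mp h2)

theorem lengthAtPrime_quotient_span_singleton_ne_top [IsDomain D] [IsNoetherianRing D]
    (hQ : Q.height ≤ 1) {c : D} (hc : c ≠ 0) :
    lengthAtPrime Q (D ⧸ Ideal.span {c}) ≠ ⊤ := by
  have hdim : Ring.KrullDimLE 1 (Localization Q.primeCompl) := by
    rw [Ring.krullDimLE_iff, IsLocalization.AtPrime.ringKrullDim_eq_height Q]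
    exact_mod_cast hQ
  have hc' : algebraMap D (Localization Q.primeCompl) c ∈
      nonZeroDivisors (Localization Q.primeCompl) := by
    rw [mem_nonZeroDivisors_iff_ne_zero]
    exact fun h => hc ((FaithfulSMul.algebraMap_eq_zero_iff _ _).mp h)
  have hfin := isFiniteLength_quotient_span_singleton (Localization Q.primeCompl) hc'
  rw [← Module.length_ne_top_iff] at hfin
  let e : Localization Q.primeCompl →ₗ[Localization Q.primeCompl]
      LocalizedModule Q.primeCompl (D ⧸ Ideal.span {c}) :=
    LinearMap.toSpanSingleton _ _ (LocalizedModule.mk 1 1)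
  have he : Function.Surjective e := by
    intro x
    induction x using LocalizedModule.induction_on with
    | h m s =>
      obtain ⟨m, rfl⟩ := Ideal.Quotient.mk_surjective m
      refine ⟨Localization.mk m s, ?_⟩
      simp only [e, LinearMap.toSpanSingleton_apply, LocalizedModule.mk_smul_mk, mul_one]
      congr 1
      rw [Algebra.smul_def, mul_one]; rfl
  have hker : Ideal.span {algebraMap D (Localization Q.primeCompl) c} ≤ LinearMap.ker e := by
    rw [Ideal.span_le, Set.singleton_subset_iff]
    simp only [SetLike.mem_coe, LinearMap.mem_ker, e, LinearMap.toSpanSingleton_apply]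
    rw [← Localization.mk_one_eq_algebraMap, LocalizedModule.mk_smul_mk, Algebra.smul_def, mul_one,
      Ideal.Quotient.algebraMap_eq, Ideal.Quotient.eq_zero_iff_mem.mpr
        (Ideal.mem_span_singleton_self c), LocalizedModule.zero_mk]
  refine ne_top_of_le_ne_top hfin (Module.length_le_of_surjective (Submodule.liftQ _ e hker) ?_)
  intro x
  obtain ⟨y, rfl⟩ := he x
  exact ⟨Submodule.Quotient.mk y, rfl⟩

/-- For a module `X` over a Noetherian domain `D` with a nonzero linear functional, `X / u X` does
not embed into a proper ideal of `D / u D`. -/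
theorem false_of_exact_smul_of_linearMap_ne_zero [IsDomain D] [IsNoetherianRing D]
    (hQ : Q.height ≤ 1) {u : D} (hu : u ≠ 0) (huQ : u ∈ Q)
    (ψ : X →ₗ[D] D ⧸ Ideal.span {u}) (hψ : ∀ x, ψ x = 0 → ∃ x', x = u • x')
    (hψQ : ∀ x d, ψ x = Ideal.Quotient.mk _ d → d ∈ Q) (φ : X →ₗ[D] D) (hφ : φ ≠ 0) : False := by
  have huQ' : Ideal.span {u} ≤ Q := by rwa [Ideal.span_le, Set.singleton_subset_iff]
  set J' : Ideal D := LinearMap.range φ with hJ'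
  obtain ⟨c, hcJ, hc⟩ : ∃ c ∈ J', c ≠ 0 := by
    obtain ⟨x, hx⟩ := DFunLike.ne_iff.mp hφ
    exact ⟨φ x, ⟨x, rfl⟩, hx⟩
  have finu := lengthAtPrime_quotient_span_singleton_ne_top Q hQ hu
  have finJ : lengthAtPrime Q (D ⧸ J') ≠ ⊤ := by
    refine ne_top_of_le_ne_top (lengthAtPrime_quotient_span_singleton_ne_top Q hQ hc)
      (lengthAtPrime_le_of_surjective Q (Submodule.factor (p := Ideal.span {c}) (p' := J') ?_)
        (Submodule.factor_surjective _))
    rwa [Ideal.span_le, Set.singleton_subset_iff]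
  -- the quotient of the target by the range of `ψ`
  have h1 := lengthAtPrime_eq_add_of_exact Q (LinearMap.range ψ).subtype (LinearMap.range ψ).mkQ
    (Submodule.subtype_injective _) (Submodule.mkQ_surjective _)
    (LinearMap.exact_subtype_mkQ _)
  have h2 : lengthAtPrime Q (D ⧸ Q) ≤
      lengthAtPrime Q ((D ⧸ Ideal.span {u}) ⧸ LinearMap.range ψ) := by
    refine lengthAtPrime_le_of_surjective Q
      (Submodule.liftQ _ (Submodule.factor (p := Ideal.span {u}) (p' := Q) huQ') ?_) ?_
    · rintro _ ⟨x, rfl⟩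
      obtain ⟨d, hd⟩ := Ideal.Quotient.mk_surjective (ψ x)
      rw [LinearMap.mem_ker, ← hd]
      exact (Submodule.Quotient.mk_eq_zero Q).mpr (hψQ x d hd.symm)
    · intro y
      obtain ⟨y, rfl⟩ := Submodule.Quotient.mk_surjective _ y
      exact ⟨Submodule.Quotient.mk (Submodule.Quotient.mk y), rfl⟩
  have h3 := lengthAtPrime_quotient_pos Q
  -- the ideal `u J'`
  let uJ : Ideal D := Ideal.span {u} * J'
  have huJ : uJ ≤ J' := Ideal.mul_le_right
  have huJu : uJ ≤ Ideal.span {u} := Ideal.mul_le_left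
  -- The length of `D / uJ'` is computed twice, through `J'` and through `uD` with `uD / uJ' ≃ D /
  -- J'`. Cancelling the finite length of `D / J'` shows that `J' / uJ'` and `D / uD` have equal
  -- length.
  have h4 : lengthAtPrime Q (D ⧸ uJ) =
      lengthAtPrime Q (LinearMap.range ((Submodule.mkQ uJ).comp J'.subtype)) +
        lengthAtPrime Q (D ⧸ J') := by
    refine lengthAtPrime_eq_add_of_exact Q (Submodule.subtype _) (Submodule.factor huJ)
      (Submodule.subtype_injective _) (Submodule.factor_surjective _) ?_
    intro y
    obtain ⟨y, rfl⟩ := Submodule.Quotient.mk_surjective _ y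
    constructor
    · intro hy
      have hy' : y ∈ J' := (Submodule.Quotient.mk_eq_zero J').mp hy
      exact ⟨⟨_, ⟨⟨y, hy'⟩, rfl⟩⟩, rfl⟩
    · rintro ⟨⟨_, ⟨⟨z, hz⟩, rfl⟩⟩, h⟩
      rw [← h]
      exact (Submodule.Quotient.mk_eq_zero J').mpr hz
  have h5 : lengthAtPrime Q (D ⧸ uJ) = lengthAtPrime Q (D ⧸ J') +
      lengthAtPrime Q (D ⧸ Ideal.span {u}) := by
    have hle : J' ≤ Submodule.comap (LinearMap.lsmul D D u) uJ := fun j hj =>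
      Ideal.mul_mem_mul (Ideal.mem_span_singleton_self u) hj
    refine lengthAtPrime_eq_add_of_exact Q (Submodule.mapQ J' uJ (LinearMap.lsmul D D u) hle)
      (Submodule.factor huJu) ?_ (Submodule.factor_surjective _) ?_
    · rw [injective_iff_map_eq_zero]
      intro y hy
      obtain ⟨y, rfl⟩ := Submodule.Quotient.mk_surjective _ y
      have : u * y ∈ uJ := (Submodule.Quotient.mk_eq_zero uJ).mp hy
      obtain ⟨z, hz, hzy⟩ := Ideal.mem_span_singleton_mul.mp this
      rw [← mul_left_cancel₀ hu hzy]
      exact (Submodule.Quotient.mk_eq_zero J').mpr hz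
    · intro y
      obtain ⟨y, rfl⟩ := Submodule.Quotient.mk_surjective _ y
      constructor
      · intro hy
        have : y ∈ Ideal.span {u} := (Submodule.Quotient.mk_eq_zero _).mp hy
        obtain ⟨z, rfl⟩ := Ideal.mem_span_singleton.mp this
        exact ⟨Submodule.Quotient.mk z, rfl⟩
      · rintro ⟨z, h⟩
        obtain ⟨z, rfl⟩ := Submodule.Quotient.mk_surjective _ z
        rw [← h]
        exact (Submodule.Quotient.mk_eq_zero _).mpr
          (Ideal.mem_span_singleton.mpr ⟨z, rfl⟩)
  -- As `ker ψ ⊆ uX` and `φ` maps `uX` into `uJ'`, the range of `ψ` surjects onto `J' / uJ'`.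
  have h6 : lengthAtPrime Q (LinearMap.range ((Submodule.mkQ uJ).comp J'.subtype)) ≤
      lengthAtPrime Q (LinearMap.range ψ) := by
    let θ : X →ₗ[D] LinearMap.range ((Submodule.mkQ uJ).comp J'.subtype) :=
      (LinearMap.rangeRestrict _).comp φ.rangeRestrict
    have hθ : Function.Surjective θ :=
      (LinearMap.surjective_rangeRestrict _).comp (LinearMap.surjective_rangeRestrict _)
    have hker : LinearMap.ker ψ ≤ LinearMap.ker θ := by
      intro x hx
      obtain ⟨x', rfl⟩ := hψ x hx
      rw [LinearMap.mem_ker]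
      apply Subtype.ext
      change Submodule.Quotient.mk (φ (u • x')) = 0
      rw [Submodule.Quotient.mk_eq_zero, map_smul]
      exact Ideal.mul_mem_mul (Ideal.mem_span_singleton_self u) ⟨x', rfl⟩
    refine lengthAtPrime_le_of_surjective Q
      ((Submodule.liftQ _ θ hker).comp ψ.quotKerEquivRange.symm.toLinearMap) ?_
    intro y
    obtain ⟨x, rfl⟩ := hθ y
    exact ⟨ψ.quotKerEquivRange (Submodule.Quotient.mk x), by
      rw [LinearMap.comp_apply, LinearEquiv.coe_coe, LinearEquiv.symm_apply_apply]; rfl⟩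
  have h7 : lengthAtPrime Q (LinearMap.range ((Submodule.mkQ uJ).comp J'.subtype)) =
      lengthAtPrime Q (D ⧸ Ideal.span {u}) := by
    rw [h4, add_comm] at h5
    exact ENat.add_right_injective_of_ne_top finJ h5
  have h8 : lengthAtPrime Q (LinearMap.range ψ) + 1 ≤ lengthAtPrime Q (LinearMap.range ψ) := by
    calc lengthAtPrime Q (LinearMap.range ψ) + 1
        ≤ lengthAtPrime Q (LinearMap.range ψ) +
          lengthAtPrime Q ((D ⧸ Ideal.span {u}) ⧸ LinearMap.range ψ) := by
          gcongr
          exact (Order.one_le_iff_pos.mpr h3).trans h2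
      _ = lengthAtPrime Q (D ⧸ Ideal.span {u}) := h1.symm
      _ ≤ _ := h7 ▸ h6
  have h9 : lengthAtPrime Q (LinearMap.range ψ) ≠ ⊤ :=
    ne_top_of_le_ne_top finu (h1 ▸ le_self_add)
  exact absurd h8 (not_le.mpr ((ENat.lt_add_one_iff h9).mpr le_rfl))

end LengthAtPrime

/-- A finitely generated module over a domain has enough functionals on non-torsion elements. -/
theorem exists_linearMap_apply_ne_zero {D J : Type*} [CommRing D] [IsDomain D] [AddCommGroup J]
    [Module D J] [Module.Finite D J] (s : J) (hs : ∀ b : D, b • s = 0 → b = 0) :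
    ∃ φ : J →ₗ[D] D, φ s ≠ 0 := by
  let S := nonZeroDivisors D
  let K := Localization S
  let V := LocalizedModule S J
  let : Field K := inferInstanceAs (Field (FractionRing D))
  have hv : (LocalizedModule.mkLinearMap S J s : V) ≠ 0 := by
    intro h
    rw [LocalizedModule.mkLinearMap_apply, ← LocalizedModule.zero_mk 1, LocalizedModule.mk_eq] at h
    obtain ⟨c, hc⟩ := h
    have h2 : (c : D) • s = 0 := by simpa [Submonoid.smul_def] using hc
    exact nonZeroDivisors.ne_zero c.2 (hs c h2)
  obtain ⟨f, hf⟩ := Module.Projective.exists_dual_ne_zero K hv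
  let g : J →ₗ[D] K := (f.restrictScalars D).comp (LocalizedModule.mkLinearMap S J)
  obtain ⟨t, ht⟩ := Module.Finite.fg_top (R := D) (M := J)
  obtain ⟨b, hb⟩ := IsLocalization.exist_integer_multiples S t g
  let h : J →ₗ[D] K := (b : D) • g
  have hr : ∀ x, h x ∈ LinearMap.range (Algebra.linearMap D K) := by
    intro x
    have hx : x ∈ Submodule.span D (t : Set J) := ht ▸ Submodule.mem_top
    induction hx using Submodule.span_induction with
    | mem x hx => obtain ⟨d, hd⟩ := hb x hx; exact ⟨d, hd⟩
    | zero => rw [map_zero]; exact zero_mem _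
    | add x y _ _ hx hy => rw [map_add]; exact add_mem hx hy
    | smul a x _ hx => rw [map_smul]; exact Submodule.smul_mem _ _ hx
  have hinj : Function.Injective (Algebra.linearMap D K) := IsFractionRing.injective D K
  refine ⟨(LinearEquiv.ofInjective _ hinj).symm.toLinearMap.comp (h.codRestrict _ hr), ?_⟩
  intro h0
  have h1 : h.codRestrict _ hr s = 0 := by
    simpa using h0
  have h2 : h s = 0 := congrArg Subtype.val h1
  have h3 : algebraMap D K b * g s = 0 := by
    rw [← Algebra.smul_def]; exact h2
  rcases mul_eq_zero.mp h3 with h4 | h4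
  · exact nonZeroDivisors.ne_zero b.2 ((FaithfulSMul.algebraMap_eq_zero_iff _ _).mp h4)
  · exact hf h4

/-- Let `E` be a finite algebra over a Noetherian domain `D` and `u ∈ D` a nonunit that is regular
on `E` and on `E / D`. If every nilpotent element of `E` lies in `D + u E`, then the nilpotent
elements of `E` are torsion. -/
theorem exists_smul_eq_zero_of_isNilpotent {D E : Type*} [CommRing D] [IsDomain D]
    [IsNoetherianRing D] [CommRing E] [Algebra D E] [Module.Finite D E] {u : D} (hu : ¬ IsUnit u)
    (hreg : ∀ e : E, u • e = 0 → e = 0)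
    (hsat : ∀ (e : E) (d : D), u • e = algebraMap D E d → ∃ d', e = algebraMap D E d')
    (hnil : ∀ e : E, IsNilpotent e → ∃ d e', e = algebraMap D E d + u • e')
    (hinj : Function.Injective (algebraMap D E))
    (s : E) (hs : IsNilpotent s) : ∃ b : D, b ≠ 0 ∧ b • s = 0 := by
  by_contra! hcon
  have hs0 : ∀ b : D, b • s = 0 → b = 0 := fun b hb => by
    by_contra h
    exact hcon b h hb
  have hu0 : u ≠ 0 := by
    rintro rfl
    have : (1 : E) = 0 := hreg 1 (zero_smul _ _)
    apply one_ne_zero (α := D)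
    exact hinj (by rw [map_one, map_zero, this])
  let J : Submodule D E := (nilradical E).restrictScalars D
  have hJ : ∀ e : E, e ∈ J ↔ IsNilpotent e := fun e => mem_nilradical
  obtain ⟨Q, hQ⟩ := Ideal.nonempty_minimalPrimes (I := Ideal.span {u})
    (by rwa [Ne, Ideal.span_singleton_eq_top])
  have hQp : Q.IsPrime := hQ.1.1
  have hQh := Ideal.height_le_one_of_isPrincipal_of_mem_minimalPrimes (Ideal.span {u}) Q hQ
  have huQ : u ∈ Q := hQ.1.2 (Ideal.mem_span_singleton_self u)
  let uE : Submodule D E := LinearMap.range (LinearMap.lsmul D E u)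
  -- `D ∩ uE = uD`, so `D / uD` embeds in `E / uE`.
  have key : ∀ d : D, algebraMap D E d ∈ uE ↔ d ∈ Ideal.span {u} := by
    intro d
    constructor
    · rintro ⟨e, he⟩
      obtain ⟨d', rfl⟩ := hsat e d he
      rw [Ideal.mem_span_singleton]
      refine ⟨d', hinj ?_⟩
      rw [← he, LinearMap.lsmul_apply, Algebra.smul_def, map_mul]
    · intro hd
      obtain ⟨d', rfl⟩ := Ideal.mem_span_singleton.mp hd
      exact ⟨algebraMap D E d', by rw [LinearMap.lsmul_apply, Algebra.smul_def, map_mul]⟩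
  let ι : (D ⧸ Ideal.span {u}) →ₗ[D] E ⧸ uE :=
    Submodule.mapQ _ _ (Algebra.linearMap D E) (fun d hd => (key d).mpr hd)
  have hι : Function.Injective ι := by
    rw [injective_iff_map_eq_zero]
    intro y hy
    obtain ⟨y, rfl⟩ := Submodule.Quotient.mk_surjective _ y
    exact (Submodule.Quotient.mk_eq_zero _).mpr
      ((key y).mp ((Submodule.Quotient.mk_eq_zero uE).mp hy))
  have hr : ∀ x : J, uE.mkQ x.1 ∈ LinearMap.range ι := by
    rintro ⟨x, hx⟩
    obtain ⟨d, e', rfl⟩ := hnil x ((hJ x).mp hx)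
    refine ⟨Submodule.Quotient.mk d, ?_⟩
    change Submodule.Quotient.mk _ = Submodule.Quotient.mk _
    rw [Submodule.Quotient.eq]
    exact ⟨-e', by simp⟩
  let ψ : J →ₗ[D] D ⧸ Ideal.span {u} := (LinearEquiv.ofInjective ι hι).symm.toLinearMap.comp
    ((uE.mkQ.comp J.subtype).codRestrict _ hr)
  have hψ : ∀ x, ι (ψ x) = uE.mkQ x.1 := fun x =>
    congrArg Subtype.val ((LinearEquiv.ofInjective ι hι).apply_symm_apply
      ((uE.mkQ.comp J.subtype).codRestrict _ hr x))
  have hJfin : Module.Finite D J := by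
    have : IsNoetherian D E := isNoetherian_of_isNoetherianRing_of_finite D E
    infer_instance
  obtain ⟨φ, hφ⟩ := exists_linearMap_apply_ne_zero (D := D) (J := J) ⟨s, (hJ s).mpr hs⟩
    (fun b hb => hs0 b (congrArg Subtype.val hb))
  refine false_of_exact_smul_of_linearMap_ne_zero Q hQh hu0 huQ ψ ?_ ?_ φ
    (fun h => hφ (by rw [h]; rfl))
  · rintro ⟨x, hx⟩ h0
    have h1 := hψ ⟨x, hx⟩
    rw [h0, map_zero] at h1
    obtain ⟨e, rfl⟩ := (Submodule.Quotient.mk_eq_zero uE).mp h1.symm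
    -- `J ∩ uE = uJ`: since `u` is regular on `E`, nilpotency of `u e` gives that of `e`.
    have he : e ∈ J := by
      rw [hJ] at hx ⊢
      obtain ⟨n, hn⟩ := hx
      refine ⟨n, ?_⟩
      rw [LinearMap.lsmul_apply, smul_pow] at hn
      clear h0 h1
      have : ∀ m : ℕ, u ^ m • e ^ n = 0 → e ^ n = 0 := by
        intro m
        induction m with
        | zero => intro h; simpa using h
        | succ m ih => intro h; rw [pow_succ', mul_smul] at h; exact ih (hreg _ h)
      exact this n hn
    exact ⟨⟨e, he⟩, rfl⟩
  · rintro ⟨x, hx⟩ d hd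
    have h1 := hψ ⟨x, hx⟩
    rw [hd] at h1
    have h2 : algebraMap D E d - x ∈ uE := (Submodule.Quotient.eq uE).mp h1
    obtain ⟨n, hn⟩ := (hJ x).mp hx
    -- `d ≡ x` mod `uE` and `x ^ n = 0`, so `d ^ n ∈ D ∩ uE = uD ⊆ Q`.
    have h3 : algebraMap D E (d ^ n) ∈ uE := by
      obtain ⟨e, he⟩ := h2
      obtain ⟨c, hc⟩ := sub_dvd_pow_sub_pow (algebraMap D E d) x n
      rw [hn, sub_zero, ← he] at hc
      refine ⟨e * c, ?_⟩
      rw [map_pow, hc]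
      simp [Algebra.smul_def, mul_assoc]
    exact hQp.mem_of_pow_mem n (hQ.1.2 ((key _).mp h3))

/-! ### Ideals of denominators and their multiplier rings -/

section Multiplier

variable {R : Type*} [CommRing R] {K : Type*} [CommRing K] [Algebra R K]

/-- The ideal of denominators of an element of an overring. -/
def denominatorIdeal (R : Type*) [CommRing R] {K : Type*} [CommRing K] [Algebra R K] (s : K) :
    Ideal R :=
  (LinearMap.range (Algebra.linearMap R K)).comap (LinearMap.toSpanSingleton R K s)

theorem mem_denominatorIdeal {s : K} {r : R} :
    r ∈ denominatorIdeal R s ↔ algebraMap R K r * s ∈ (algebraMap R K).range := by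
  simp only [denominatorIdeal, Submodule.mem_comap, LinearMap.toSpanSingleton_apply,
    LinearMap.mem_range, Algebra.linearMap_apply, RingHom.mem_range, Algebra.smul_def]

theorem denominatorIdeal_le_mul (s : K) (b : R) :
    denominatorIdeal R s ≤ denominatorIdeal R (algebraMap R K b * s) := by
  intro r hr
  rw [mem_denominatorIdeal] at hr ⊢
  rw [mul_left_comm]
  exact mul_mem ⟨b, rfl⟩ hr

theorem mem_denominatorIdeal_mul {s : K} {a b : R} :
    a ∈ denominatorIdeal R (algebraMap R K b * s) ↔ a * b ∈ denominatorIdeal R s := by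
  rw [mem_denominatorIdeal, mem_denominatorIdeal, map_mul, mul_assoc]

/-- The ring of multipliers of an ideal inside an overring. -/
def multiplierRing (K : Type*) [CommRing K] [Algebra R K] (c : Ideal R) : Subalgebra R K where
  carrier := {τ | ∀ x ∈ c, ∃ y ∈ c, τ * algebraMap R K x = algebraMap R K y}
  mul_mem' := by
    intro a b ha hb x hx
    obtain ⟨y, hy, h⟩ := hb x hx
    obtain ⟨z, hz, h'⟩ := ha y hy
    exact ⟨z, hz, by rw [mul_assoc, h, h']⟩
  add_mem' := by
    intro a b ha hb x hx
    obtain ⟨y, hy, h⟩ := ha x hx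
    obtain ⟨z, hz, h'⟩ := hb x hx
    exact ⟨y + z, add_mem hy hz, by rw [add_mul, h, h', map_add]⟩
  algebraMap_mem' r x hx := ⟨r * x, c.mul_mem_left r hx, by rw [map_mul]⟩

/-- For `x` in the ideal of denominators `P`, both `x s` and `(x s) s` lie in `R`, so `x s ∈ P`. If
`τ P ⊆ R` then `(τ x) s = τ (x s) ∈ R`, that is, `τ x ∈ P`: here `(R : P) = (P : P)`. -/
theorem mem_multiplierRing_denominatorIdeal {s : K}
    (hs : ∀ r ∈ denominatorIdeal R s, algebraMap R K r * s ^ 2 ∈ (algebraMap R K).range) {τ : K} :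
    τ ∈ multiplierRing K (denominatorIdeal R s) ↔
      ∀ x ∈ denominatorIdeal R s, τ * algebraMap R K x ∈ (algebraMap R K).range := by
  constructor
  · intro h x hx
    obtain ⟨y, -, hy⟩ := h x hx
    exact ⟨y, hy.symm⟩
  · intro h x hx
    obtain ⟨y, hy⟩ := h x hx
    refine ⟨y, ?_, hy.symm⟩
    rw [mem_denominatorIdeal, hy, mul_assoc]
    obtain ⟨x', hx'⟩ := mem_denominatorIdeal.mp hx
    rw [← hx']
    apply h
    rw [mem_denominatorIdeal, hx', mul_assoc, ← pow_two]
    exact hs x hx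

theorem self_mem_multiplierRing {s : K}
    (hs : ∀ r ∈ denominatorIdeal R s, algebraMap R K r * s ^ 2 ∈ (algebraMap R K).range) :
    s ∈ multiplierRing K (denominatorIdeal R s) := by
  rw [mem_multiplierRing_denominatorIdeal hs]
  intro x hx
  rw [mul_comm]
  exact mem_denominatorIdeal.mp hx

variable [IsFractionRing R K]

/-- Multiplication by `d` embeds the multiplier ring into the Noetherian module `R`. -/
theorem finite_multiplierRing [IsNoetherianRing R] {c : Ideal R} {d : R} (hd : d ∈ c)
    (hd' : d ∈ nonZeroDivisors R) : Module.Finite R (multiplierRing K c) := by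
  suffices h : (Subalgebra.toSubmodule (multiplierRing K c)).FG from Module.Finite.of_fg h
  let f : K →ₗ[R] K := LinearMap.mulLeft R (algebraMap R K d)
  have hf : Function.Injective f := by
    intro a b hab
    exact (IsLocalization.map_units K ⟨d, hd'⟩).mul_left_cancel hab
  refine Submodule.fg_of_fg_map_injective f hf ?_
  have hle : (Subalgebra.toSubmodule (multiplierRing K c)).map f ≤
      LinearMap.range (Algebra.linearMap R K) := by
    rintro _ ⟨τ, hτ, rfl⟩
    obtain ⟨y, -, hy⟩ := hτ d hd
    exact ⟨y, by rw [LinearMap.mulLeft_apply, mul_comm, hy]; rfl⟩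
  have : IsNoetherian R (LinearMap.range (Algebra.linearMap R K)) := inferInstance
  exact isNoetherian_submodule.mp this _ hle

/-- If `R / u R` is reduced then `R` is `u`-integrally closed. -/
theorem mem_range_of_isIntegral_of_mul_mem_range {u : R} (hu : u ∈ nonZeroDivisors R)
    (hred : (Ideal.span {u}).IsRadical) {τ : K} (hτ : IsIntegral R τ)
    (h : algebraMap R K u * τ ∈ (algebraMap R K).range) : τ ∈ (algebraMap R K).range := by
  obtain ⟨r, hr⟩ := h
  obtain ⟨p, hp, hpτ⟩ := hτ
  -- Scaling the roots by `u` turns the equation of `τ` into a monic equation for `r = u τ` whose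
  -- lower coefficients are divisible by `u`. So a power of `r` lies in `uR`, and hence `r` does.
  have h1 := Polynomial.scaleRoots_aeval_eq_zero (r := u) (p := p) (a := τ) hpτ
  rw [← hr, Polynomial.aeval_algebraMap_apply, IsFractionRing.to_map_eq_zero_iff,
    Polynomial.coe_aeval_eq_eval, Polynomial.eval_eq_sum_range, Polynomial.natDegree_scaleRoots,
    Finset.sum_range_succ, Polynomial.coeff_scaleRoots_natDegree, hp.leadingCoeff, one_mul] at h1
  have h2 : r ^ p.natDegree ∈ Ideal.span {u} := by
    rw [← neg_eq_iff_add_eq_zero] at h1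
    rw [← h1]
    refine neg_mem (Ideal.sum_mem _ fun i hi => ?_)
    rw [Polynomial.coeff_scaleRoots]
    refine Ideal.mul_mem_right _ _ (Ideal.mul_mem_left _ _ ?_)
    exact Ideal.pow_mem_of_mem _ (Ideal.mem_span_singleton_self u) _
      (Nat.sub_pos_of_lt (Finset.mem_range.mp hi))
  obtain ⟨r', rfl⟩ := Ideal.mem_span_singleton.mp (hred ⟨_, h2⟩)
  refine ⟨r', ?_⟩
  rw [map_mul] at hr
  exact (IsLocalization.map_units K ⟨u, hu⟩).mul_left_cancel hr

theorem mem_range_of_mem_multiplierRing_of_mul_mem_range [IsNoetherianRing R] {c : Ideal R} {d : R}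
    (hd : d ∈ c) (hd' : d ∈ nonZeroDivisors R) {u : R} (hu : u ∈ nonZeroDivisors R)
    (hred : (Ideal.span {u}).IsRadical) {τ : K} (hτ : τ ∈ multiplierRing K c)
    (h : algebraMap R K u * τ ∈ (algebraMap R K).range) : τ ∈ (algebraMap R K).range := by
  have := finite_multiplierRing (K := K) hd hd'
  refine mem_range_of_isIntegral_of_mul_mem_range hu hred ?_ h
  have h2 : IsIntegral R (⟨τ, hτ⟩ : multiplierRing K c) := IsIntegral.of_finite R _
  exact h2.map (multiplierRing K c).val

/-- The candidate is `τ' = (w - a) / u`. For a denominator `x`, the `k`-th power of `(w - a) x ∈ R`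
is `u τ x ^ k ∈ uR`; as `uR` is radical, `(w - a) x ∈ uR`, so `τ' x ∈ R`. -/
theorem exists_eq_add_mul_of_sub_pow_eq {s : K}
    (hs : ∀ r ∈ denominatorIdeal R s, algebraMap R K r * s ^ 2 ∈ (algebraMap R K).range)
    {u : R} (hu : u ∈ nonZeroDivisors R) (hred : (Ideal.span {u}).IsRadical) {w τ : K}
    (hw : w ∈ multiplierRing K (denominatorIdeal R s))
    (hτ : τ ∈ multiplierRing K (denominatorIdeal R s)) {a : R} {k : ℕ} (hk : k ≠ 0)
    (h : (w - algebraMap R K a) ^ k = algebraMap R K u * τ) :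
    ∃ τ' ∈ multiplierRing K (denominatorIdeal R s),
      w = algebraMap R K a + algebraMap R K u * τ' := by
  have hunit := IsLocalization.map_units K ⟨u, hu⟩
  obtain ⟨v, hv⟩ := hunit.exists_right_inv
  refine ⟨v * (w - algebraMap R K a), ?_, ?_⟩
  · rw [mem_multiplierRing_denominatorIdeal hs]
    intro x hx
    have hwa : w - algebraMap R K a ∈ multiplierRing K (denominatorIdeal R s) :=
      sub_mem hw (Subalgebra.algebraMap_mem _ a)
    obtain ⟨r, hr, hr'⟩ := hwa x hx
    have hxk : x ^ k ∈ denominatorIdeal R s := Ideal.pow_mem_of_mem _ hx k (Nat.pos_of_ne_zero hk)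
    obtain ⟨q, hq, hq'⟩ := hτ _ hxk
    have h1 : r ^ k = u * q := by
      apply IsFractionRing.injective R K
      rw [map_pow, map_mul, ← hq', ← hr', mul_pow, h, map_pow, mul_assoc]
    obtain ⟨r', rfl⟩ := Ideal.mem_span_singleton.mp
      (hred ⟨k, h1 ▸ Ideal.mul_mem_right _ _ (Ideal.mem_span_singleton_self u)⟩)
    refine ⟨r', ?_⟩
    rw [mul_assoc, hr', map_mul, ← mul_assoc, mul_comm v, hv, one_mul]
  · rw [← mul_assoc, hv, one_mul]
    ring

end Multiplier

/-! ### Deformation of seminormality -/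

section Deformation

variable {R : Type*} [CommRing R] [IsNoetherianRing R] {K : Type*} [CommRing K] [Algebra R K]
  [IsFractionRing R K]

theorem isRadical_span_of_isReduced_quotient {R : Type*} [CommRing R] {I : Ideal R}
    (h : IsReduced (R ⧸ I)) : I.IsRadical :=
  (Ideal.isRadical_iff_quotient_reduced I).mpr h

/-- If `R / u R` is seminormal, then `R + u T` is seminormal in the ring of multipliers `T`. -/
theorem exists_eq_add_mul_of_sq_of_cube {u : R} (hu : u ∈ nonZeroDivisors R)
    (hG : IsSeminormalRing (R ⧸ Ideal.span {u})) {s : K}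
    (hs : ∀ r ∈ denominatorIdeal R s, algebraMap R K r * s ^ 2 ∈ (algebraMap R K).range)
    {d : R} (hd : d ∈ denominatorIdeal R s) (hd' : d ∈ nonZeroDivisors R) {w : K}
    (hw : w ∈ multiplierRing K (denominatorIdeal R s))
    (h2 : ∃ a : R, ∃ τ ∈ multiplierRing K (denominatorIdeal R s),
      w ^ 2 = algebraMap R K a + algebraMap R K u * τ)
    (h3 : ∃ a : R, ∃ τ ∈ multiplierRing K (denominatorIdeal R s),
      w ^ 3 = algebraMap R K a + algebraMap R K u * τ) :
    ∃ a : R, ∃ τ ∈ multiplierRing K (denominatorIdeal R s),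
      w = algebraMap R K a + algebraMap R K u * τ := by
  have hred := isRadical_span_of_isReduced_quotient hG.reduced
  set T := multiplierRing K (denominatorIdeal R s) with hT
  have hR : ∀ r, algebraMap R K r ∈ T := fun r => Subalgebra.algebraMap_mem _ r
  obtain ⟨y, α, hα, hy⟩ := h2
  obtain ⟨z, β, hβ, hz⟩ := h3
  have h6 : Ideal.Quotient.mk (Ideal.span {u}) y ^ 3 =
      Ideal.Quotient.mk (Ideal.span {u}) z ^ 2 := by
    rw [← map_pow, ← map_pow, Ideal.Quotient.eq, Ideal.mem_span_singleton]
    let γ : K := (2 * algebraMap R K z * β + algebraMap R K u * β ^ 2) -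
      (3 * algebraMap R K y ^ 2 * α + 3 * algebraMap R K y * algebraMap R K u * α ^ 2 +
        algebraMap R K u ^ 2 * α ^ 3)
    have hγ : algebraMap R K (y ^ 3 - z ^ 2) = algebraMap R K u * γ := by
      have e : (w ^ 2) ^ 3 = (w ^ 3) ^ 2 := by ring
      rw [hy, hz] at e
      simp only [map_sub, map_pow, γ]
      linear_combination e
    have hγT : γ ∈ T := by
      have hn : ∀ n : ℕ, (n : K) ∈ T := fun n => natCast_mem T n
      have h2 := hn 2
      have h3 := hn 3
      push_cast at h2 h3
      exact sub_mem (add_mem (mul_mem (mul_mem h2 (hR z)) hβ) (mul_mem (hR u) (pow_mem hβ 2)))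
        (add_mem (add_mem (mul_mem (mul_mem h3 (pow_mem (hR y) 2)) hα)
          (mul_mem (mul_mem (mul_mem h3 (hR y)) (hR u)) (pow_mem hα 2)))
          (mul_mem (pow_mem (hR u) 2) (pow_mem hα 3)))
    obtain ⟨r, hr⟩ := mem_range_of_mem_multiplierRing_of_mul_mem_range hd hd' hu hred hγT
      ⟨_, hγ⟩
    refine ⟨r, IsFractionRing.injective R K ?_⟩
    rw [hγ, map_mul, hr]
  obtain ⟨a, ha2, ha3⟩ := hG.exists_sq_cube _ _ h6
  obtain ⟨a, rfl⟩ := Ideal.Quotient.mk_surjective a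
  rw [← map_pow, Ideal.Quotient.eq, Ideal.mem_span_singleton] at ha2 ha3
  obtain ⟨b2, hb2⟩ := ha2
  obtain ⟨b3, hb3⟩ := ha3
  -- The witness comes from `(w - a)³ = 4 (w³ - a³) - 3 (a + w) (w² - a²)`, where both differences
  -- on the right lie in `uT`.
  refine ⟨a, exists_eq_add_mul_of_sub_pow_eq hs hu hred hw (k := 3)
    (τ := 4 * (β + algebraMap R K b3) - 3 * algebraMap R K a * (α + algebraMap R K b2) -
      3 * w * (α + algebraMap R K b2)) ?_ (by norm_num) ?_⟩
  · have h4 := natCast_mem T 4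
    have h3 := natCast_mem T 3
    push_cast at h4 h3
    exact sub_mem (sub_mem (mul_mem h4 (add_mem hβ (hR _)))
      (mul_mem (mul_mem h3 (hR a)) (add_mem hα (hR _))))
      (mul_mem (mul_mem h3 hw) (add_mem hα (hR _)))
  · have e2 := congrArg (algebraMap R K) hb2
    have e3 := congrArg (algebraMap R K) hb3
    simp only [map_sub, map_pow, map_mul] at e2 e3
    linear_combination (-3 * algebraMap R K a - 3 * w) * hy + 4 * hz +
      (-3 * algebraMap R K a - 3 * w) * e2 + 4 * e3

/-- A nilpotent element of `T` modulo the denominator ideal lies in `R + u T`. -/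
theorem exists_eq_add_mul_of_pow_mem {u : R} (hu : u ∈ nonZeroDivisors R)
    (hG : IsSeminormalRing (R ⧸ Ideal.span {u})) {s : K}
    (hs : ∀ r ∈ denominatorIdeal R s, algebraMap R K r * s ^ 2 ∈ (algebraMap R K).range)
    {d : R} (hd : d ∈ denominatorIdeal R s) (hd' : d ∈ nonZeroDivisors R) {w : K}
    (hw : w ∈ multiplierRing K (denominatorIdeal R s)) (n : ℕ)
    (h : ∀ k, n + 1 ≤ k → w ^ k ∈ (algebraMap R K).range) :
    ∃ a : R, ∃ τ ∈ multiplierRing K (denominatorIdeal R s),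
      w = algebraMap R K a + algebraMap R K u * τ := by
  -- Descending induction: if all powers beyond the `k`-th lie in `R + uT`, so do the square and
  -- cube of `w ^ k`, and hence `w ^ k`.
  have key : ∀ j : ℕ, (∀ k, j + 1 ≤ k → ∃ a : R, ∃ τ ∈ multiplierRing K (denominatorIdeal R s),
      w ^ k = algebraMap R K a + algebraMap R K u * τ) →
      ∃ a : R, ∃ τ ∈ multiplierRing K (denominatorIdeal R s),
      w = algebraMap R K a + algebraMap R K u * τ := by
    intro j
    induction j with
    | zero => intro h; simpa using h 1 le_rfl
    | succ j ih =>
      intro h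
      refine ih fun k hk => ?_
      rcases hk.eq_or_lt with rfl | hk
      · refine exists_eq_add_mul_of_sq_of_cube hu hG hs hd hd' (pow_mem hw _) ?_ ?_
        · rw [← pow_mul]; exact h _ (by omega)
        · rw [← pow_mul]; exact h _ (by omega)
      · exact h k hk
  refine key n fun k hk => ?_
  obtain ⟨a, ha⟩ := h k hk
  exact ⟨a, 0, zero_mem _, by rw [ha, mul_zero, add_zero]⟩

/-- The length argument applies to `D = R / P` and `E = T / P`, where `s` is nilpotent because `s² ∈
P`. Torsion of `s` gives `b ∉ P` with `b s ∈ R`, against the definition of `P`. -/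
theorem false_of_isPrime_denominatorIdeal {u : R} (hu : u ∈ nonZeroDivisors R)
    (hG : IsSeminormalRing (R ⧸ Ideal.span {u})) {s : K}
    (hs2 : s ^ 2 ∈ (algebraMap R K).range) (hs3 : s ^ 3 ∈ (algebraMap R K).range)
    (hP : (denominatorIdeal R s).IsPrime)
    (hPu : ∀ g ∈ denominatorIdeal R s, g - 1 ∉ Ideal.span {u})
    {d : R} (hd : d ∈ denominatorIdeal R s) (hd' : d ∈ nonZeroDivisors R) : False := by
  have hred := isRadical_span_of_isReduced_quotient hG.reduced
  have hs : ∀ r ∈ denominatorIdeal R s, algebraMap R K r * s ^ 2 ∈ (algebraMap R K).range :=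
    fun r _ => mul_mem ⟨r, rfl⟩ hs2
  have hsT := self_mem_multiplierRing hs
  have hinjK := IsFractionRing.injective R K
  have hfin := finite_multiplierRing (K := K) hd hd'
  have hsatT : ∀ {τ : K}, τ ∈ multiplierRing K (denominatorIdeal R s) →
      algebraMap R K u * τ ∈ (algebraMap R K).range → τ ∈ (algebraMap R K).range :=
    fun hτ h => mem_range_of_mem_multiplierRing_of_mul_mem_range hd hd' hu hred hτ h
  have hnilT : ∀ {w : K}, w ∈ multiplierRing K (denominatorIdeal R s) → ∀ n : ℕ,
    (∀ k, n + 1 ≤ k → w ^ k ∈ (algebraMap R K).range) →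
    ∃ a : R, ∃ τ ∈ multiplierRing K (denominatorIdeal R s),
      w = algebraMap R K a + algebraMap R K u * τ :=
    fun hw n h => exists_eq_add_mul_of_pow_mem hu hG hs hd hd' hw n h
  obtain ⟨y, hy⟩ := hs2
  have hyP : y ∈ denominatorIdeal R s := by
    rw [mem_denominatorIdeal, hy, ← pow_succ]; exact hs3
  have hsP : ∀ r ∈ denominatorIdeal R s, algebraMap R K r * s ∈ (algebraMap R K).range :=
    fun r hr => mem_denominatorIdeal.mp hr
  have hs1 : ∀ r, algebraMap R K r * s ∈ (algebraMap R K).range → r ∈ denominatorIdeal R s :=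
    fun r hr => mem_denominatorIdeal.mpr hr
  have h1P : (1 : R) ∉ denominatorIdeal R s := (Ideal.ne_top_iff_one _).mp hP.ne_top
  clear hs hs3 hG
  generalize denominatorIdeal R s = P at *
  -- If `u s ∈ R`, saturation would give `s ∈ R`, that is, `1 ∈ P`.
  have huP : u ∉ P := fun h => h1P (hs1 1 (by
    rw [map_one, one_mul]; exact hsatT hsT (hsP u h)))
  let T := multiplierRing K P
  let 𝔭 : Ideal T :=
    { carrier := {τ | ∃ x ∈ P, (τ : K) = algebraMap R K x}
      add_mem' := by
        rintro a b ⟨x, hx, hx'⟩ ⟨y, hy, hy'⟩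
        exact ⟨x + y, add_mem hx hy, by simp [hx', hy']⟩
      zero_mem' := ⟨0, zero_mem _, by simp⟩
      smul_mem' := by
        rintro c a ⟨x, hx, hx'⟩
        obtain ⟨z, hz, hz'⟩ := c.2 x hx
        exact ⟨z, hz, by rw [smul_eq_mul, MulMemClass.coe_mul, hx', hz']⟩ }
  have mem𝔭 : ∀ τ : T, τ ∈ 𝔭 ↔ ∃ x ∈ P, (τ : K) = algebraMap R K x := fun τ => Iff.rfl
  have hle : P ≤ 𝔭.comap (algebraMap R T) := fun x hx => ⟨x, hx, rfl⟩
  let _ : Algebra (R ⧸ P) (T ⧸ 𝔭) := (Ideal.quotientMap 𝔭 (algebraMap R T) hle).toAlgebra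
  have halg : ∀ r : R, algebraMap (R ⧸ P) (T ⧸ 𝔭) (Ideal.Quotient.mk P r) =
      Ideal.Quotient.mk 𝔭 (algebraMap R T r) := fun r => rfl
  have : IsScalarTower R (R ⧸ P) (T ⧸ 𝔭) := IsScalarTower.of_algebraMap_eq fun r => rfl
  have : Module.Finite R (T ⧸ 𝔭) := inferInstance
  have : Module.Finite (R ⧸ P) (T ⧸ 𝔭) := Module.Finite.of_restrictScalars_finite R _ _
  have hsmul : ∀ (r : R) (τ : T), (Ideal.Quotient.mk P r) • (Ideal.Quotient.mk 𝔭 τ) =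
      Ideal.Quotient.mk 𝔭 (algebraMap R T r * τ) := fun r τ => by
    rw [Algebra.smul_def, halg, map_mul]
  have hcoe : ∀ r : R, ((algebraMap R T r : T) : K) = algebraMap R K r := fun r => rfl
  suffices h : ∃ b : R ⧸ P, b ≠ 0 ∧ b • (Ideal.Quotient.mk 𝔭 ⟨s, hsT⟩) = 0 by
    obtain ⟨b, hb, hbs⟩ := h
    obtain ⟨b, rfl⟩ := Ideal.Quotient.mk_surjective b
    rw [hsmul, Ideal.Quotient.eq_zero_iff_mem] at hbs
    obtain ⟨x, -, hx⟩ := hbs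
    exact hb (Ideal.Quotient.eq_zero_iff_mem.mpr (hs1 b ⟨x, hx.symm⟩))
  refine exists_smul_eq_zero_of_isNilpotent (D := R ⧸ P) (E := T ⧸ 𝔭)
    (u := Ideal.Quotient.mk P u) ?_ ?_ ?_ ?_ ?_ (Ideal.Quotient.mk 𝔭 ⟨s, hsT⟩) ?_
  -- If `u v ≡ 1` mod `P`, then `1 - u v` is an element of `P` congruent to `1` mod `u`, which `hPu`
  -- excludes.
  · intro h
    obtain ⟨v, hv⟩ := h.exists_right_inv
    obtain ⟨v, rfl⟩ := Ideal.Quotient.mk_surjective v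
    rw [← map_mul, ← map_one (Ideal.Quotient.mk P), eq_comm, Ideal.Quotient.eq] at hv
    refine hPu _ hv (Ideal.mem_span_singleton.mpr ⟨-v, by ring⟩)
  · intro e he
    obtain ⟨e, rfl⟩ := Ideal.Quotient.mk_surjective e
    rw [hsmul, Ideal.Quotient.eq_zero_iff_mem] at he
    obtain ⟨x, hx, hx'⟩ := he
    obtain ⟨r, hr⟩ := hsatT e.2 ⟨x, hx'.symm⟩
    rw [Ideal.Quotient.eq_zero_iff_mem]
    refine ⟨r, ?_, hr.symm⟩
    have : u * r = x := hinjK (by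
      rw [map_mul, hr, ← hx']; rfl)
    exact (hP.mem_or_mem (this ▸ hx)).resolve_left huP
  · intro e d he
    obtain ⟨e, rfl⟩ := Ideal.Quotient.mk_surjective e
    obtain ⟨d, rfl⟩ := Ideal.Quotient.mk_surjective d
    rw [hsmul, halg, Ideal.Quotient.eq] at he
    obtain ⟨x, hx, hx'⟩ := he
    obtain ⟨r, hr⟩ := hsatT e.2 ⟨x + d, by
      rw [map_add, ← hx', AddSubgroupClass.coe_sub, MulMemClass.coe_mul, hcoe, hcoe]; ring⟩
    exact ⟨Ideal.Quotient.mk P r, by rw [halg]; congr 1; exact Subtype.ext hr.symm⟩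
  · intro e he
    obtain ⟨e, rfl⟩ := Ideal.Quotient.mk_surjective e
    obtain ⟨n, hn⟩ := he
    rw [← map_pow, Ideal.Quotient.eq_zero_iff_mem] at hn
    obtain ⟨a, τ, hτ, h⟩ := hnilT e.2 n (fun k hk => by
      have : e ^ k ∈ 𝔭 := by
        obtain ⟨m, rfl⟩ := Nat.exists_eq_add_of_le (show n ≤ k by omega)
        rw [pow_add]; exact 𝔭.mul_mem_right _ hn
      obtain ⟨x, -, hx⟩ := this
      exact ⟨x, hx.symm⟩)
    refine ⟨Ideal.Quotient.mk P a, Ideal.Quotient.mk 𝔭 ⟨τ, hτ⟩, ?_⟩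
    rw [halg, hsmul, ← map_add]
    congr 1
    exact Subtype.ext h
  · rw [injective_iff_map_eq_zero]
    intro d hd0
    obtain ⟨d, rfl⟩ := Ideal.Quotient.mk_surjective d
    rw [halg, Ideal.Quotient.eq_zero_iff_mem] at hd0
    obtain ⟨x, hx, hx'⟩ := hd0
    rw [Ideal.Quotient.eq_zero_iff_mem, hinjK hx']
    exact hx
  · refine ⟨2, ?_⟩
    rw [← map_pow, Ideal.Quotient.eq_zero_iff_mem]
    exact ⟨y, hyP, hy.symm⟩

/-- If `R / u R` is seminormal, then `R` is seminormal near the locus `u = 0`. -/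
theorem exists_mul_mem_range_of_sq_of_cube {u : R} (hu : u ∈ nonZeroDivisors R)
    (hG : IsSeminormalRing (R ⧸ Ideal.span {u})) (s : K)
    (hs2 : s ^ 2 ∈ (algebraMap R K).range) (hs3 : s ^ 3 ∈ (algebraMap R K).range) :
    ∃ g : R, g - 1 ∈ Ideal.span {u} ∧ algebraMap R K g * s ∈ (algebraMap R K).range := by
  by_contra! hcon
  let F : Set (Ideal R) := {P | ∃ s : K, s ^ 2 ∈ (algebraMap R K).range ∧
    s ^ 3 ∈ (algebraMap R K).range ∧ P = denominatorIdeal R s ∧ ∀ g ∈ P, g - 1 ∉ Ideal.span {u}}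
  have hF : F.Nonempty := ⟨_, s, hs2, hs3, rfl, fun g hg hg' =>
    hcon g hg' (mem_denominatorIdeal.mp hg)⟩
  obtain ⟨P, ⟨t, ht2, ht3, rfl, ht⟩, hmax⟩ := set_has_maximal_iff_noetherian.mpr ‹_› F hF
  -- Replacing `t` by `b t` enlarges the ideal of denominators to its colon by `b`. By maximality
  -- either nothing changes or some `g ≡ 1` mod `u` enters; the set of such `g` is multiplicatively
  -- closed, so the maximal ideal of denominators is prime.
  have hmul : ∀ b : R, (∀ g ∈ denominatorIdeal R (algebraMap R K b * t), g - 1 ∉ Ideal.span {u}) →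
      ∀ a, a * b ∈ denominatorIdeal R t → a ∈ denominatorIdeal R t := by
    intro b hb a hab
    by_contra ha
    refine hmax (denominatorIdeal R (algebraMap R K b * t)) ⟨_, ?_, ?_, rfl, hb⟩
      (lt_of_le_of_ne (denominatorIdeal_le_mul t b) fun h => ha ?_)
    · rw [mul_pow]; exact mul_mem (pow_mem (RingHom.mem_range_self _ b) 2) ht2
    · rw [mul_pow]; exact mul_mem (pow_mem (RingHom.mem_range_self _ b) 3) ht3
    · rw [h, mem_denominatorIdeal_mul]; exact hab
  have hW : ∀ {g g' : R}, g - 1 ∈ Ideal.span {u} → g' - 1 ∈ Ideal.span {u} →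
      g * g' - 1 ∈ Ideal.span {u} := by
    intro g g' h h'
    have : g * g' - 1 = g * (g' - 1) + (g - 1) := by ring
    rw [this]
    exact add_mem (Ideal.mul_mem_left _ _ h') h
  have hprime : (denominatorIdeal R t).IsPrime := by
    refine ⟨fun h => ht 1 (h ▸ Submodule.mem_top) (by simp), ?_⟩
    intro a b hab
    by_contra! hcon
    obtain ⟨ha, hb⟩ := hcon
    have h1 : ¬ ∀ g ∈ denominatorIdeal R (algebraMap R K b * t), g - 1 ∉ Ideal.span {u} :=
      fun h => ha (hmul b h a hab)
    push Not at h1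
    obtain ⟨g, hg, hg'⟩ := h1
    rw [mem_denominatorIdeal_mul] at hg
    have h2 : ¬ ∀ g' ∈ denominatorIdeal R (algebraMap R K g * t), g' - 1 ∉ Ideal.span {u} :=
      fun h => hb (hmul g h b (by rwa [mul_comm]))
    push Not at h2
    obtain ⟨g', hg1, hg2⟩ := h2
    rw [mem_denominatorIdeal_mul] at hg1
    exact ht _ hg1 (hW hg2 hg')
  obtain ⟨⟨z, d⟩, hzd⟩ := IsLocalization.surj (nonZeroDivisors R) t
  exact false_of_isPrime_denominatorIdeal hu hG ht2 ht3 hprime ht (d := d)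
    (mem_denominatorIdeal.mpr ⟨z, by rw [mul_comm, hzd]⟩) d.2

end Deformation

theorem eq_of_sq_eq_sq_of_cube_eq_cube {L : Type*} [CommRing L] [IsReduced L] {a b : L}
    (h2 : a ^ 2 = b ^ 2) (h3 : a ^ 3 = b ^ 3) : a = b := by
  have h : (a - b) ^ 3 = 0 := by linear_combination -(3 * b + 3 * a) * h2 + 4 * h3
  exact sub_eq_zero.mp (pow_eq_zero_iff (by norm_num) |>.mp h)

/-! ### Seminormal rings inside reduced overrings -/

section Closed

variable {A : Type*} [CommRing A] {L : Type*} [CommRing L] [IsReduced L] [Algebra A L]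

theorem IsSeminormalRing.mem_range_of_sq_of_cube (hA : IsSeminormalRing A)
    (hinj : Function.Injective (algebraMap A L)) {b : L}
    (h2 : b ^ 2 ∈ (algebraMap A L).range) (h3 : b ^ 3 ∈ (algebraMap A L).range) :
    b ∈ (algebraMap A L).range := by
  obtain ⟨y, hy⟩ := h2
  obtain ⟨z, hz⟩ := h3
  obtain ⟨x, rfl, rfl⟩ := hA.exists_sq_cube y z (hinj (by
    rw [map_pow, map_pow, hy, hz]; ring))
  rw [map_pow] at hy hz
  exact ⟨x, eq_of_sq_eq_sq_of_cube_eq_cube hy hz⟩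

theorem IsSeminormalRing.mem_range_of_pow (hA : IsSeminormalRing A)
    (hinj : Function.Injective (algebraMap A L)) {b : L} (n : ℕ)
    (h : ∀ k, n + 1 ≤ k → b ^ k ∈ (algebraMap A L).range) : b ∈ (algebraMap A L).range := by
  induction n with
  | zero => simpa using h 1 le_rfl
  | succ n ih =>
    refine ih fun k hk => ?_
    rcases hk.eq_or_lt with rfl | hk
    · apply hA.mem_range_of_sq_of_cube hinj
      · rw [← pow_mul]; exact h _ (by omega)
      · rw [← pow_mul]; exact h _ (by omega)
    · exact h k hk

/-- If `x ^ p` and `r x` lie in a seminormal ring, then so does `r x ^ i` for every `i`. -/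
theorem IsSeminormalRing.mul_pow_mem_range (hA : IsSeminormalRing A)
    (hinj : Function.Injective (algebraMap A L)) {x : L} {p : ℕ} (hp : 0 < p)
    (hx : x ^ p ∈ (algebraMap A L).range) {r : A}
    (hr : algebraMap A L r * x ∈ (algebraMap A L).range) (i : ℕ) :
    algebraMap A L r * x ^ i ∈ (algebraMap A L).range := by
  refine hA.mem_range_of_pow hinj p fun k hk => ?_
  have hlt := Nat.mod_lt (i * k) hp
  -- With `k > p`, write `x ^ (i k)` as a power of `x ^ p` times `x` to an exponent below `p`. There
  -- are enough factors `r` to pair with the remaining `x`.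
  obtain ⟨m, hm⟩ := Nat.exists_eq_add_of_le (show i * k % p ≤ k by omega)
  have : (algebraMap A L r * x ^ i) ^ k =
      (algebraMap A L r * x) ^ (i * k % p) * algebraMap A L r ^ m * (x ^ p) ^ (i * k / p) := by
    rw [mul_pow, ← pow_mul, mul_pow, ← pow_mul]
    conv_lhs => rw [← Nat.mod_add_div (i * k) p, pow_add x, hm, pow_add (algebraMap A L r)]
    rw [← hm]
    ring
  rw [this]
  exact mul_mem (mul_mem (pow_mem hr _) (pow_mem (RingHom.mem_range_self _ r) _)) (pow_mem hx _)

end Closed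

theorem isReduced_of_isFractionRing (R K : Type*) [CommRing R] [CommRing K] [Algebra R K]
    [IsFractionRing R K] [IsReduced R] : IsReduced K := by
  refine ⟨fun x ⟨n, hn⟩ => ?_⟩
  obtain ⟨⟨z, d⟩, h⟩ := IsLocalization.surj (nonZeroDivisors R) x
  have hz : z ^ n = 0 := IsFractionRing.injective R K (by
    rw [map_pow, ← h, mul_pow, hn, zero_mul, map_zero])
  rw [show z = 0 from IsReduced.eq_zero z ⟨n, hz⟩, map_zero] at h
  exact (IsLocalization.map_units K d).mul_left_eq_zero.mp h

/-! ### Deformation of weak normality -/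

section Deformation

variable {R : Type*} [CommRing R] [IsNoetherianRing R] {K : Type*} [CommRing K] [Algebra R K]
  [IsFractionRing R K]

/-- Otherwise some `e ∉ uR` kills the ideal of denominators modulo `u`. Then `e / u` is a
multiplier, and `u (e / u) = e ∈ R` puts it in `R`, so `e ∈ uR`. -/
theorem exists_mem_denominatorIdeal_quotient_mem_nonZeroDivisors {u : R}
    (hu : u ∈ nonZeroDivisors R) (hred : (Ideal.span {u}).IsRadical) {s : K}
    (hs : ∀ r ∈ denominatorIdeal R s, algebraMap R K r * s ^ 2 ∈ (algebraMap R K).range)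
    {d : R} (hd : d ∈ denominatorIdeal R s) (hd' : d ∈ nonZeroDivisors R) :
    ∃ c ∈ denominatorIdeal R s,
      Ideal.Quotient.mk (Ideal.span {u}) c ∈ nonZeroDivisors (R ⧸ Ideal.span {u}) := by
  by_contra! hcon
  have hdis : Disjoint
      (((denominatorIdeal R s).map (Ideal.Quotient.mk (Ideal.span {u})) :
        Ideal (R ⧸ Ideal.span {u})) : Set (R ⧸ Ideal.span {u}))
      (nonZeroDivisors (R ⧸ Ideal.span {u})) := by
    rw [Set.disjoint_left]
    intro y hy
    obtain ⟨c, hc, rfl⟩ := (Ideal.mem_map_iff_of_surjective _ Ideal.Quotient.mk_surjective).mp hy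
    exact hcon c hc
  obtain ⟨-, e, he, he0⟩ := SetLike.lt_iff_le_and_exists.mp
    (Ideal.bot_lt_annihilator_of_disjoint_nonZeroDivisors hdis)
  obtain ⟨e, rfl⟩ := Ideal.Quotient.mk_surjective e
  rw [Submodule.mem_annihilator] at he
  apply he0
  rw [Ideal.mem_bot, Ideal.Quotient.eq_zero_iff_mem]
  obtain ⟨v, hv⟩ := (IsLocalization.map_units K ⟨u, hu⟩).exists_right_inv
  have huv : algebraMap R K u * (v * algebraMap R K e) = algebraMap R K e := by
    rw [← mul_assoc, hv, one_mul]
  have hT : v * algebraMap R K e ∈ multiplierRing K (denominatorIdeal R s) := by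
    rw [mem_multiplierRing_denominatorIdeal hs]
    intro x hx
    have h1 := he _ (Ideal.mem_map_of_mem _ hx)
    rw [smul_eq_mul, ← map_mul, Ideal.Quotient.eq_zero_iff_mem, Ideal.mem_span_singleton] at h1
    obtain ⟨q, hq⟩ := h1
    refine ⟨q, ?_⟩
    have h2 : algebraMap R K e * algebraMap R K x = algebraMap R K u * algebraMap R K q := by
      rw [← map_mul, hq, map_mul]
    rw [mul_assoc, h2, ← mul_assoc, mul_comm v, hv, one_mul]
  obtain ⟨r, hr⟩ := mem_range_of_mem_multiplierRing_of_mul_mem_range hd hd' hu hred hT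
    ⟨e, huv.symm⟩
  rw [Ideal.mem_span_singleton]
  refine ⟨r, IsFractionRing.injective R K ?_⟩
  rw [map_mul, hr, huv]

/-- A denominator `c` that is regular mod `u` turns `w` into the fraction `(w c) / c` over `R / uR`.
Weak normality there yields `a` with `w ^ p - a ^ p` and `p (w - a)` in `uT`, and so `(w - a) ^ p ∈
uT` by the binomial theorem. -/
theorem exists_eq_add_mul_of_pow_prime {u : R} (hu : u ∈ nonZeroDivisors R)
    (hG : IsWeaklyNormalRing (R ⧸ Ideal.span {u})) {p : ℕ} (hp : p.Prime) {s : K}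
    (hs : ∀ r ∈ denominatorIdeal R s, algebraMap R K r * s ^ 2 ∈ (algebraMap R K).range)
    (hps : (p : R) ∈ denominatorIdeal R s)
    {d : R} (hd : d ∈ denominatorIdeal R s) (hd' : d ∈ nonZeroDivisors R) {w : K}
    (hw : w ∈ multiplierRing K (denominatorIdeal R s))
    (hwp : ∃ a : R, ∃ τ ∈ multiplierRing K (denominatorIdeal R s),
      w ^ p = algebraMap R K a + algebraMap R K u * τ) :
    ∃ a : R, ∃ τ ∈ multiplierRing K (denominatorIdeal R s),
      w = algebraMap R K a + algebraMap R K u * τ := by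
  have hred := isRadical_span_of_isReduced_quotient hG.seminormal.reduced
  have hinjK := IsFractionRing.injective R K
  obtain ⟨c, hc, hc'⟩ := exists_mem_denominatorIdeal_quotient_mem_nonZeroDivisors hu hred hs hd hd'
  obtain ⟨y, τ, hτ, hy⟩ := hwp
  obtain ⟨z, -, hz⟩ := hw c hc
  obtain ⟨v, -, hv⟩ := hw p hps
  obtain ⟨q, -, hq⟩ := hτ (c ^ p) (Ideal.pow_mem_of_mem _ hc p hp.pos)
  obtain ⟨a, ha, hav⟩ := hG.exists_pow_mul p hp (Ideal.Quotient.mk _ y) (Ideal.Quotient.mk _ z)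
    (Ideal.Quotient.mk _ v) (Ideal.Quotient.mk _ c) hc' (by
      rw [← map_pow, ← map_pow, ← map_mul, Ideal.Quotient.eq, Ideal.mem_span_singleton]
      refine ⟨q, hinjK ?_⟩
      rw [map_sub, map_mul, map_mul, map_pow, ← hz, ← hq, mul_pow, hy, map_pow]
      ring) (by
      rw [← map_natCast (Ideal.Quotient.mk _), ← map_mul, ← map_mul]
      congr 1
      apply hinjK
      rw [map_mul, map_mul, ← hz, ← hv]
      ring)
  obtain ⟨a, rfl⟩ := Ideal.Quotient.mk_surjective a
  rw [← map_pow, Ideal.Quotient.eq, Ideal.mem_span_singleton] at ha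
  rw [← map_natCast (Ideal.Quotient.mk _), ← map_mul, Ideal.Quotient.eq,
    Ideal.mem_span_singleton] at hav
  obtain ⟨b1, hb1⟩ := ha
  obtain ⟨b2, hb2⟩ := hav
  let T := multiplierRing K (denominatorIdeal R s)
  obtain ⟨ρ, hρ⟩ := exists_add_pow_prime_eq hp (algebraMap R T a)
    ((⟨w, hw⟩ : T) - algebraMap R T a)
  have hρ' := congrArg (Subtype.val) hρ
  have hcoe : ∀ r : R, ((algebraMap R T r : T) : K) = algebraMap R K r := fun r => rfl
  simp only [add_sub_cancel, SubmonoidClass.coe_pow, AddMemClass.coe_add, MulMemClass.coe_mul,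
    AddSubgroupClass.coe_sub, hcoe] at hρ'
  have hcast : ((p : T) : K) = (p : K) := rfl
  rw [hcast] at hρ'
  refine ⟨a, exists_eq_add_mul_of_sub_pow_eq hs hu hred hw (k := p)
    (τ := τ + algebraMap R K b1 - algebraMap R K a * algebraMap R K b2 * (ρ : K)) ?_ hp.ne_zero ?_⟩
  · exact sub_mem (add_mem hτ (Subalgebra.algebraMap_mem _ _))
      (mul_mem (mul_mem (Subalgebra.algebraMap_mem _ _) (Subalgebra.algebraMap_mem _ _)) ρ.2)
  · have e1 := congrArg (algebraMap R K) hb1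
    have e2 := congrArg (algebraMap R K) hb2
    simp only [map_sub, map_pow, map_mul, map_natCast] at e1 e2 hv
    linear_combination hy - hρ' + e1 - algebraMap R K a * (ρ : K) * (e2 + hv)

/-- If `R` is seminormal and `R / u R` is weakly normal, then `R` is weakly normal near the locus
`u = 0`. -/
theorem exists_mul_mem_range_of_pow_prime {u : R} (hu : u ∈ nonZeroDivisors R)
    (hR : IsSeminormalRing R) (hG : IsWeaklyNormalRing (R ⧸ Ideal.span {u})) {p : ℕ}
    (hp : p.Prime) (s : K) (hsp : s ^ p ∈ (algebraMap R K).range)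
    (hps : (p : K) * s ∈ (algebraMap R K).range) :
    ∃ g : R, g - 1 ∈ Ideal.span {u} ∧ algebraMap R K g * s ∈ (algebraMap R K).range := by
  have := hR.reduced
  have : IsReduced K := isReduced_of_isFractionRing R K
  have hinjK := IsFractionRing.injective R K
  have hred := isRadical_span_of_isReduced_quotient hG.seminormal.reduced
  -- Here seminormality of `R` replaces the condition `s² ∈ R` available in the seminormal case.
  have hs : ∀ r ∈ denominatorIdeal R s, algebraMap R K r * s ^ 2 ∈ (algebraMap R K).range :=
    fun r hr => hR.mul_pow_mem_range hinjK hp.pos hsp (mem_denominatorIdeal.mp hr) 2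
  have hpP : (p : R) ∈ denominatorIdeal R s := by
    rw [mem_denominatorIdeal, map_natCast]; exact hps
  obtain ⟨⟨z, d⟩, hzd⟩ := IsLocalization.surj (nonZeroDivisors R) s
  have hd : (d : R) ∈ denominatorIdeal R s :=
    mem_denominatorIdeal.mpr ⟨z, by rw [mul_comm, hzd]⟩
  have hfin := finite_multiplierRing (K := K) hd d.2
  set T := multiplierRing K (denominatorIdeal R s) with hT
  have hRT : ∀ r, algebraMap R K r ∈ T := fun r => Subalgebra.algebraMap_mem _ r
  have hpT : ∀ τ ∈ T, (p : K) * τ ∈ (algebraMap R K).range := by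
    intro τ hτ
    obtain ⟨y, -, hy⟩ := hτ p hpP
    exact ⟨y, by rw [← hy, map_natCast, mul_comm]⟩
  -- Closed under addition because `p T ⊆ R` absorbs the mixed terms of a `p ^ n`-th power.
  let E : Submodule R K :=
    { carrier := {w | w ∈ T ∧ ∃ n, w ^ p ^ n ∈ (algebraMap R K).range}
      zero_mem' := ⟨zero_mem _, 0, by simp⟩
      add_mem' := by
        rintro a b ⟨ha, n, hn⟩ ⟨hb, m, hm⟩
        refine ⟨add_mem ha hb, n + m, ?_⟩
        obtain ⟨ρ, hρ⟩ := exists_add_pow_prime_pow_eq hp (⟨a, ha⟩ : T) ⟨b, hb⟩ (n + m)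
        have hρ' := congrArg Subtype.val hρ
        simp only [SubmonoidClass.coe_pow, AddMemClass.coe_add, MulMemClass.coe_mul] at hρ'
        rw [hρ']
        refine add_mem (add_mem ?_ ?_) ?_
        · rw [pow_add, pow_mul]; exact pow_mem hn _
        · rw [pow_add, mul_comm, pow_mul]; exact pow_mem hm _
        · rw [mul_assoc, mul_assoc]
          exact hpT _ (mul_mem ha (mul_mem hb ρ.2))
      smul_mem' := by
        rintro c a ⟨ha, n, hn⟩
        refine ⟨Subalgebra.smul_mem _ ha c, n, ?_⟩
        rw [Algebra.smul_def, mul_pow]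
        exact mul_mem (pow_mem (RingHom.mem_range_self _ c) _) hn }
  have hstep : ∀ w ∈ T, ∀ n, w ^ p ^ n ∈ (algebraMap R K).range →
      ∃ a : R, ∃ τ ∈ T, w = algebraMap R K a + algebraMap R K u * τ := by
    intro w hw n
    induction n generalizing w with
    | zero =>
      rintro ⟨a, ha⟩
      exact ⟨a, 0, zero_mem _, by rw [ha]; simp⟩
    | succ n ih =>
      intro h
      refine exists_eq_add_mul_of_pow_prime hu hG hp hs hpP hd d.2 hw (ih _ (pow_mem hw p) ?_)
      rwa [← pow_mul, ← pow_succ']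
  have hsat : ∀ τ ∈ T, ∀ m, algebraMap R K u ^ m * τ ∈ (algebraMap R K).range →
      τ ∈ (algebraMap R K).range := by
    intro τ hτ m
    induction m with
    | zero => intro h; simpa using h
    | succ m ih =>
      intro h
      refine ih (mem_range_of_mem_multiplierRing_of_mul_mem_range hd d.2 hu hred
        (mul_mem (pow_mem (hRT u) m) hτ) ?_)
      rwa [← mul_assoc, ← pow_succ']
  have hET : E ≤ Subalgebra.toSubmodule T := fun w hw => hw.1
  have hEfg : E.FG := by
    have : IsNoetherian R (Subalgebra.toSubmodule T) :=
      isNoetherian_of_isNoetherianRing_of_finite R T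
    exact isNoetherian_submodule.mp this E hET
  obtain ⟨g, hg, hgE⟩ := Submodule.exists_sub_one_mem_and_smul_le_of_fg_of_le_sup
    (I := Ideal.span {u}) (N := LinearMap.range (Algebra.linearMap R K)) (N' := E) (P := E)
    hEfg le_rfl (by
      intro w hw
      obtain ⟨a, τ, hτ, h⟩ := hstep w hw.1 _ hw.2.choose_spec
      -- `u τ = w - a` has a `p ^ m`-th power in `R`; saturation removes the factor `u ^ p ^ m`.
      -- Hence `E ⊆ R + uE`, as Nakayama's lemma requires.
      have hτE : τ ∈ E := by
        have hwa : w - algebraMap R K a ∈ E := sub_mem hw ⟨hRT a, 0, by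
          rw [pow_zero, pow_one]; exact RingHom.mem_range_self _ a⟩
        obtain ⟨-, m, hm⟩ := hwa
        refine ⟨hτ, m, hsat _ (pow_mem hτ _) (p ^ m) ?_⟩
        rw [← mul_pow]
        rwa [h, add_sub_cancel_left] at hm
      rw [h]
      refine add_mem (Submodule.mem_sup_left ⟨a, rfl⟩) (Submodule.mem_sup_right ?_)
      rw [← Algebra.smul_def]
      exact Submodule.smul_mem_smul (Ideal.mem_span_singleton_self u) hτE)
  refine ⟨g, hg, ?_⟩
  have hsE : s ∈ E := ⟨self_mem_multiplierRing hs, 1, by rwa [pow_one]⟩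
  obtain ⟨r, hr⟩ := hgE (Submodule.smul_mem_pointwise_smul s g E hsE)
  exact ⟨r, by rw [← Algebra.smul_def]; exact hr⟩

end Deformation

/-! ### Transfer to root-closed subrings, isomorphic rings and products -/

section Transfer

theorem IsSeminormalRing.of_injective {R S : Type*} [CommRing R] [CommRing S]
    (hS : IsSeminormalRing S) (f : R →+* S) (hf : Function.Injective f)
    (h : ∀ (x : S) (n : ℕ), n ≠ 0 → x ^ n ∈ f.range → x ∈ f.range) : IsSeminormalRing R := by
  have := hS.reduced
  refine ⟨isReduced_of_injective f hf, fun y z hyz => ?_⟩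
  obtain ⟨x, hx2, hx3⟩ := hS.exists_sq_cube (f y) (f z) (by rw [← map_pow, hyz, map_pow])
  obtain ⟨x, rfl⟩ := h x 2 two_ne_zero ⟨y, hx2⟩
  exact ⟨x, hf (by rw [hx2, map_pow]), hf (by rw [hx3, map_pow])⟩

theorem IsWeaklyNormalRing.of_injective {R S : Type*} [CommRing R] [CommRing S]
    (hS : IsWeaklyNormalRing S) (f : R →+* S) (hf : Function.Injective f)
    (h : ∀ (x : S) (n : ℕ), n ≠ 0 → x ^ n ∈ f.range → x ∈ f.range)
    (hd : ∀ d ∈ nonZeroDivisors R, f d ∈ nonZeroDivisors S) : IsWeaklyNormalRing R := by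
  refine ⟨hS.seminormal.of_injective f hf h, fun p hp y z w d hdR hyz hzw => ?_⟩
  obtain ⟨x, hxp, hxw⟩ := hS.exists_pow_mul p hp (f y) (f z) (f w) (f d) (hd d hdR)
    (by rw [← map_pow, hyz, map_mul, map_pow]) (by rw [← map_mul, ← hzw, map_mul, map_natCast])
  obtain ⟨x, rfl⟩ := h x p hp.ne_zero ⟨y, hxp⟩
  exact ⟨x, hf (by rw [hxp, map_pow]), hf (by rw [hxw, map_mul, map_natCast])⟩

theorem IsSeminormalRing.of_ringEquiv {R S : Type*} [CommRing R] [CommRing S]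
    (hS : IsSeminormalRing S) (e : R ≃+* S) : IsSeminormalRing R :=
  hS.of_injective e.toRingHom e.injective fun x _ _ _ => ⟨e.symm x, e.apply_symm_apply x⟩

theorem IsWeaklyNormalRing.of_ringEquiv {R S : Type*} [CommRing R] [CommRing S]
    (hS : IsWeaklyNormalRing S) (e : R ≃+* S) : IsWeaklyNormalRing R :=
  hS.of_injective e.toRingHom e.injective (fun x _ _ _ => ⟨e.symm x, e.apply_symm_apply x⟩)
    fun d hd => by
      rw [mem_nonZeroDivisors_iff_right] at hd ⊢
      intro x hx
      have h1 := hd (e.symm x) (e.injective (by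
        rw [map_mul, e.apply_symm_apply, map_zero]; exact hx))
      exact e.symm.map_eq_zero_iff.mp h1

theorem isWeaklyNormalRing_of_isIntegrallyClosed (R : Type*) [CommRing R] [IsDomain R]
    [IsIntegrallyClosed R] : IsWeaklyNormalRing R := by
  refine ⟨⟨inferInstance, fun y z h => ?_⟩, fun p hp y z w d hd h1 h2 => ?_⟩
  · rcases eq_or_ne y 0 with rfl | hy
    · refine ⟨0, by simp, ?_⟩
      have : z ^ 2 = 0 := by rw [← h]; ring
      rw [pow_eq_zero_iff two_ne_zero |>.mp this]
      ring
    · obtain ⟨x, rfl⟩ := (IsIntegrallyClosed.pow_dvd_pow_iff two_ne_zero).mp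
        (show y ^ 2 ∣ z ^ 2 from ⟨y, by rw [← h]; ring⟩)
      have hx : y = x ^ 2 := mul_left_cancel₀ (pow_ne_zero 2 hy) (by linear_combination h)
      exact ⟨x, hx, by rw [pow_succ x 2, ← hx]⟩
  · have hd0 := nonZeroDivisors.ne_zero hd
    obtain ⟨x, rfl⟩ := (IsIntegrallyClosed.pow_dvd_pow_iff hp.ne_zero).mp
        (show d ^ p ∣ z ^ p from ⟨y, by rw [h1]; ring⟩)
    refine ⟨x, mul_left_cancel₀ (pow_ne_zero p hd0) ?_, mul_left_cancel₀ hd0 ?_⟩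
    · rw [mul_comm, ← h1, mul_pow]
    · rw [← h2]; ring

theorem isWeaklyNormalRing_pi {ι : Type*} (R : ι → Type*) [∀ i, CommRing (R i)]
    (h : ∀ i, IsWeaklyNormalRing (R i)) : IsWeaklyNormalRing (∀ i, R i) := by
  classical
  refine ⟨⟨⟨fun x ⟨n, hn⟩ => ?_⟩, fun y z hyz => ?_⟩, fun p hp y z w d hd h1 h2 => ?_⟩
  · funext i
    have := (h i).seminormal.reduced
    exact IsReduced.eq_zero _ ⟨n, congrFun hn i⟩
  · choose x hx using fun i => (h i).seminormal.exists_sq_cube (y i) (z i) (congrFun hyz i)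
    exact ⟨x, funext fun i => (hx i).1, funext fun i => (hx i).2⟩
  · have hdi : ∀ i, d i ∈ nonZeroDivisors (R i) := by
      intro i
      rw [mem_nonZeroDivisors_iff_right] at hd ⊢
      intro x hx
      have h3 := hd (Pi.single i x) (by
        funext j
        rcases eq_or_ne j i with rfl | hj
        · simpa using hx
        · simp [hj])
      simpa using congrFun h3 i
    choose x hx using fun i => (h i).exists_pow_mul p hp (y i) (z i) (w i) (d i) (hdi i)
      (congrFun h1 i) (congrFun h2 i)
    exact ⟨x, funext fun i => (hx i).1, funext fun i => (hx i).2⟩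

end Transfer

/-! ### Polynomials over the total ring of fractions -/

section FractionRing

/-- A maximal ideal `M` of a Noetherian total ring of fractions is the annihilator of some `x`, and
reducedness gives `x ∉ M`. A prime `Q ⊆ M` contains `M x = 0` but not `x`, so `Q = M` and the
dimension is zero. -/
theorem isArtinianRing_of_isFractionRing_self (K : Type*) [CommRing K] [IsNoetherianRing K]
    [IsReduced K] [IsFractionRing K K] : IsArtinianRing K := by
  rw [isArtinianRing_iff_isNoetherianRing_krullDimLE_zero]
  refine ⟨inferInstance, Ring.krullDimLE_zero_iff.mpr fun Q hQ => ?_⟩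
  obtain ⟨M, hM, hQM⟩ := Q.exists_le_maximal hQ.ne_top
  have hass := Ideal.IsMaximal.mem_associatedPrimes_of_isFractionRing K M
  rw [AssociatedPrimes.mem_iff, isAssociatedPrime_iff] at hass
  obtain ⟨hprime, x, hx⟩ := hass
  have hann : ∀ m ∈ M, m * x = 0 := fun m hm => by
    rw [hx, Submodule.mem_colon_singleton] at hm
    simpa using hm
  have hxM : x ∉ M := by
    intro h
    have h0 : x = 0 := IsReduced.eq_zero x ⟨2, by rw [pow_two]; exact hann x h⟩
    refine hprime.ne_top ((Ideal.eq_top_iff_one _).mpr ?_)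
    rw [hx, Submodule.mem_colon_singleton, h0]
    simp
  have : M ≤ Q := fun m hm =>
    (hQ.mem_or_mem (show m * x ∈ Q by rw [hann m hm]; exact zero_mem _)).resolve_right
      fun h => hxM (hQM h)
  rwa [le_antisymm hQM this]

open Polynomial in
-- The total ring of fractions is a finite product of fields, so its polynomial ring is a product of
-- integrally closed domains.
theorem isWeaklyNormalRing_polynomial_fractionRing (A : Type*) [CommRing A] [IsNoetherianRing A]
    [IsReduced A] : IsWeaklyNormalRing (FractionRing A)[X] := by
  have : IsNoetherianRing (FractionRing A) :=
    IsLocalization.isNoetherianRing (nonZeroDivisors A) _ inferInstance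
  have : IsReduced (FractionRing A) := isReduced_of_isFractionRing A _
  have : IsArtinianRing (FractionRing A) := isArtinianRing_of_isFractionRing_self _
  refine IsWeaklyNormalRing.of_ringEquiv (isWeaklyNormalRing_pi
    (fun M : MaximalSpectrum (FractionRing A) => (FractionRing A ⧸ M.asIdeal)[X]) fun M => ?_)
    ((Polynomial.mapEquiv (IsArtinianRing.equivPi (FractionRing A)).toRingEquiv).trans
      (Polynomial.piEquiv _))
  let _ : Field (FractionRing A ⧸ M.asIdeal) := Ideal.Quotient.field _
  exact isWeaklyNormalRing_of_isIntegrallyClosed _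

end FractionRing

/-! ### Polynomial extensions -/

section Polynomial

open Polynomial

attribute [local instance] Polynomial.algebra

/-- Induction from the top coefficient of `x` down: the coefficient of `h x` in degree `deg h + i`
is `lc(h) x_i` plus terms involving only `x_j` with `j > i`. -/
theorem leadingCoeff_pow_mul_coeff_mem_range {A L : Type*} [CommRing A] [CommRing L]
    [Algebra A L] {h : A[X]} {x : L[X]}
    (hx : h.map (algebraMap A L) * x ∈ (mapRingHom (algebraMap A L)).range) (k i : ℕ)
    (hi : x.natDegree < i + k) :
    algebraMap A L h.leadingCoeff ^ k * x.coeff i ∈ (algebraMap A L).range := by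
  rw [mem_map_range] at hx
  induction k generalizing i with
  | zero =>
    rw [coeff_eq_zero_of_natDegree_lt (by simpa using hi), mul_zero]
    exact zero_mem _
  | succ k ih =>
    have h1 := hx (h.natDegree + i)
    rw [coeff_mul, ← Finset.add_sum_erase _ _
      (show (h.natDegree, i) ∈ Finset.HasAntidiagonal.antidiagonal (h.natDegree + i) by simp),
      coeff_map, coeff_natDegree] at h1
    have h2 : algebraMap A L h.leadingCoeff ^ k *
        ∑ q ∈ (Finset.HasAntidiagonal.antidiagonal (h.natDegree + i)).erase (h.natDegree, i),
          (h.map (algebraMap A L)).coeff q.1 * x.coeff q.2 ∈ (algebraMap A L).range := by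
      rw [Finset.mul_sum]
      refine sum_mem fun q hq => ?_
      rw [Finset.mem_erase, Finset.HasAntidiagonal.mem_antidiagonal] at hq
      rw [coeff_map, mul_left_comm]
      rcases lt_trichotomy q.2 i with h3 | h3 | h3
      · rw [coeff_eq_zero_of_natDegree_lt (p := h) (by omega), map_zero, zero_mul]
        exact zero_mem _
      · exact absurd (Prod.ext (by simp only; omega) h3) hq.1
      · exact mul_mem (RingHom.mem_range_self _ _) (ih q.2 (by omega))
    have h3 := sub_mem (mul_mem (pow_mem (RingHom.mem_range_self (algebraMap A L)
      h.leadingCoeff) k) h1) h2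
    convert h3 using 1
    ring

theorem map_mem_nonZeroDivisors_of_isFractionRing {A L : Type*} [CommRing A] [CommRing L]
    [Algebra A L] [IsFractionRing A L] {d : A[X]}
    (hd : d ∈ nonZeroDivisors A[X]) : d.map (algebraMap A L) ∈ nonZeroDivisors L[X] := by
  have hinj := map_injective _ (IsFractionRing.injective A L)
  rw [mem_nonZeroDivisors_iff_right] at hd ⊢
  intro x hx
  obtain ⟨b, hbA, hb⟩ := IsLocalization.integerNormalization_spec (nonZeroDivisors A) x
  have h0 : IsLocalization.integerNormalization (nonZeroDivisors A) x = 0 := by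
    refine hd _ (hinj ?_)
    rw [Polynomial.map_mul, hb, smul_mul_assoc, hx, smul_zero, Polynomial.map_zero]
  rw [h0, Polynomial.map_zero] at hb
  ext i
  have h1 := congrArg (fun q : L[X] => q.coeff i) hb
  simp only [coeff_zero, coeff_smul] at h1
  rw [Algebra.smul_def] at h1
  exact (IsLocalization.map_units L ⟨b, hbA⟩).mul_right_eq_zero.mp h1.symm

variable {A : Type*} [CommRing A] {L : Type*} [CommRing L] [IsReduced L] [Algebra A L]

/-- If `m` is the degree of an integral equation of `β`, then `c ^ (n m)` carries every power of `β`
into `A`. So all large powers of `c β` lie in `A`, and seminormality gives `c β` itself. -/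
theorem IsSeminormalRing.mul_mem_range_of_pow_mul_mem_range (hA : IsSeminormalRing A)
    (hinj : Function.Injective (algebraMap A L)) {c : A} {β : L} (hβ : IsIntegral A β) (n : ℕ)
    (h : algebraMap A L c ^ n * β ∈ (algebraMap A L).range) :
    algebraMap A L c * β ∈ (algebraMap A L).range := by
  obtain ⟨q, hq, hqβ⟩ := hβ
  set m := q.natDegree with hm
  have hβm : β ^ m = -∑ i ∈ Finset.range m, algebraMap A L (q.coeff i) * β ^ i := by
    rw [← aeval_def, aeval_eq_sum_range, Finset.sum_range_succ, coeff_natDegree, hq.leadingCoeff,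
      one_smul] at hqβ
    simp only [Algebra.smul_def] at hqβ
    linear_combination hqβ
  have key : ∀ j : ℕ, algebraMap A L c ^ (n * m) * β ^ j ∈ (algebraMap A L).range := by
    intro j
    induction j using Nat.strong_induction_on with
    | _ j ih =>
      rcases le_or_gt j m with hj | hj
      · obtain ⟨k, hk⟩ := Nat.exists_eq_add_of_le hj
        have : algebraMap A L c ^ (n * m) * β ^ j =
            (algebraMap A L c ^ n * β) ^ j * algebraMap A L c ^ (n * k) := by
          rw [hk]; ring
        rw [this]
        exact mul_mem (pow_mem h j) (pow_mem (RingHom.mem_range_self _ c) _)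
      · obtain ⟨k, hk⟩ := Nat.exists_eq_add_of_lt hj
        have : algebraMap A L c ^ (n * m) * β ^ j = -∑ i ∈ Finset.range m,
            algebraMap A L (q.coeff i) * (algebraMap A L c ^ (n * m) * β ^ (i + k + 1)) := by
          rw [hk, add_assoc m, pow_add, hβm, ← mul_assoc, mul_neg, neg_mul, Finset.mul_sum,
            Finset.sum_mul]
          congr 1
          exact Finset.sum_congr rfl fun i _ => by ring
        rw [this]
        refine neg_mem (sum_mem fun i hi => mul_mem (RingHom.mem_range_self _ _) (ih _ ?_))
        have := Finset.mem_range.mp hi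
        omega
  refine hA.mem_range_of_pow hinj (n * m) fun k hk => ?_
  obtain ⟨l, hl⟩ := Nat.exists_eq_add_of_lt hk
  have : (algebraMap A L c * β) ^ k =
      algebraMap A L c ^ (l + 1) * (algebraMap A L c ^ (n * m) * β ^ k) := by
    rw [mul_pow]
    conv_lhs => rw [hl, pow_add, pow_add, pow_add, pow_one]
    rw [hl]; ring
  rw [this]
  exact mul_mem (pow_mem (RingHom.mem_range_self _ c) _) (key k)

theorem IsSeminormalRing.mul_mem_range_of_mem_adjoin (hA : IsSeminormalRing A)
    (hinj : Function.Injective (algebraMap A L)) {S : Set L} (hS : ∀ x ∈ S, IsIntegral A x) {c : A}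
    (hc : ∀ x ∈ S, algebraMap A L c * x ∈ (algebraMap A L).range) {β : L}
    (hβ : β ∈ Algebra.adjoin A S) : algebraMap A L c * β ∈ (algebraMap A L).range := by
  suffices h : ∃ n : ℕ, algebraMap A L c ^ n * β ∈ (algebraMap A L).range by
    obtain ⟨n, hn⟩ := h
    exact hA.mul_mem_range_of_pow_mul_mem_range hinj
      (Algebra.adjoin_le (S := integralClosure A L) hS hβ) n hn
  induction hβ using Algebra.adjoin_induction with
  | mem x hx => exact ⟨1, by rw [pow_one]; exact hc x hx⟩
  | algebraMap r => exact ⟨0, by rw [pow_zero, one_mul]; exact RingHom.mem_range_self _ _⟩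
  | add x y _ _ hx hy =>
    obtain ⟨n, hn⟩ := hx
    obtain ⟨m, hm⟩ := hy
    refine ⟨n + m, ?_⟩
    have : algebraMap A L c ^ (n + m) * (x + y) =
        algebraMap A L c ^ m * (algebraMap A L c ^ n * x) +
          algebraMap A L c ^ n * (algebraMap A L c ^ m * y) := by ring
    rw [this]
    exact add_mem (mul_mem (pow_mem (RingHom.mem_range_self _ c) _) hn)
      (mul_mem (pow_mem (RingHom.mem_range_self _ c) _) hm)
  | mul x y _ _ hx hy =>
    obtain ⟨n, hn⟩ := hx
    obtain ⟨m, hm⟩ := hy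
    refine ⟨n + m, ?_⟩
    have : algebraMap A L c ^ (n + m) * (x * y) =
        (algebraMap A L c ^ n * x) * (algebraMap A L c ^ m * y) := by ring
    rw [this]
    exact mul_mem hn hm

/-- The leading coefficient of `h` carries all coefficients of `x` into `A`, first to a power and
then, by seminormality, to the first power. The leading term can then be removed from `h`. -/
theorem IsSeminormalRing.coeff_mul_coeff_mem_range (hA : IsSeminormalRing A)
    (hinj : Function.Injective (algebraMap A L)) {h : A[X]} {x : L[X]}
    (hint : ∀ i, IsIntegral A (x.coeff i))
    (hx : h.map (algebraMap A L) * x ∈ (mapRingHom (algebraMap A L)).range) (j i : ℕ) :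
    algebraMap A L (h.coeff j) * x.coeff i ∈ (algebraMap A L).range := by
  induction hn : h.support.card using Nat.strong_induction_on generalizing h j with
  | _ n ih =>
    by_cases h0 : h = 0
    · rw [h0, coeff_zero, map_zero, zero_mul]; exact zero_mem _
    have hlead : ∀ i, algebraMap A L h.leadingCoeff * x.coeff i ∈ (algebraMap A L).range :=
      fun i => hA.mul_mem_range_of_pow_mul_mem_range hinj (hint i) _
        (leadingCoeff_pow_mul_coeff_mem_range hx (x.natDegree + 1) i (by omega))
    rcases eq_or_ne j h.natDegree with rfl | hj
    · exact hlead i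
    · rw [← eraseLead_coeff_of_ne j hj]
      refine ih _ (hn ▸ eraseLead_support_card_lt h0) ?_ j rfl
      have : h.eraseLead.map (algebraMap A L) * x = h.map (algebraMap A L) * x -
          X ^ h.natDegree * (C (algebraMap A L h.leadingCoeff) * x) := by
        conv_rhs => rw [← h.eraseLead_add_C_mul_X_pow]
        simp only [Polynomial.map_add, Polynomial.map_mul, Polynomial.map_pow, map_X, map_C]
        rw [h.eraseLead_add_C_mul_X_pow]
        ring
      rw [this]
      refine sub_mem hx (mul_mem (pow_mem (RingHom.mem_range.mpr ⟨X, by simp⟩) _) ?_)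
      rw [mem_map_range]
      intro k
      rw [coeff_C_mul]
      exact hlead k

/-- Let `B` be generated by the coefficients of `x`, and `f = x²`. Since `f x = x³` is defined over
`A`, the coefficients of `f` lie in the conductor of `B` into `A`. Modulo it `x² = 0`, so the
coefficients of `x` are nilpotent there and their large powers lie in `A`. -/
theorem IsSeminormalRing.mem_range_map_of_sq_of_cube (hA : IsSeminormalRing A)
    (hinj : Function.Injective (algebraMap A L)) {x : L[X]}
    (h2 : x ^ 2 ∈ (mapRingHom (algebraMap A L)).range)
    (h3 : x ^ 3 ∈ (mapRingHom (algebraMap A L)).range) :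
    x ∈ (mapRingHom (algebraMap A L)).range := by
  obtain ⟨f, hf⟩ := h2
  rw [coe_mapRingHom] at hf
  have hint : ∀ i, IsIntegral A (x.coeff i) := by
    rw [← isIntegral_iff_isIntegral_coeff]
    refine IsIntegral.of_pow (n := 2) (by norm_num) ?_
    rw [← hf]
    exact isIntegral_algebraMap
  let S : Set L := Set.range x.coeff
  have hS : ∀ y ∈ S, IsIntegral A y := by
    rintro _ ⟨i, rfl⟩; exact hint i
  have hfS : ∀ j, ∀ β ∈ Algebra.adjoin A S,
      algebraMap A L (f.coeff j) * β ∈ (algebraMap A L).range := by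
    intro j β hβ
    refine hA.mul_mem_range_of_mem_adjoin hinj hS ?_ hβ
    rintro _ ⟨i, rfl⟩
    exact hA.coeff_mul_coeff_mem_range hinj hint (by rw [hf, ← pow_succ]; exact h3) j i
  let B := Algebra.adjoin A S
  let 𝔠 : Ideal B :=
    { carrier := {b | ∀ β ∈ B, (b : L) * β ∈ (algebraMap A L).range}
      add_mem' := fun {a b} ha hb β hβ => by
        rw [AddMemClass.coe_add, add_mul]; exact add_mem (ha β hβ) (hb β hβ)
      zero_mem' := fun β _ => by rw [ZeroMemClass.coe_zero, zero_mul]; exact zero_mem _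
      smul_mem' := fun c {a} ha β hβ => by
        rw [smul_eq_mul, MulMemClass.coe_mul, mul_comm (c : L), mul_assoc]
        exact ha _ (mul_mem c.2 hβ) }
  have hxB : x ∈ (mapRingHom (algebraMap B L)).range := by
    rw [mem_map_range]
    exact fun n => ⟨⟨x.coeff n, Algebra.subset_adjoin ⟨n, rfl⟩⟩, rfl⟩
  obtain ⟨xB, hxB⟩ := hxB
  have hcoeff : ∀ n, ((xB.coeff n : B) : L) = x.coeff n := fun n => by
    rw [← hxB, coe_mapRingHom, coeff_map]; rfl
  have hsq : xB.map (Ideal.Quotient.mk 𝔠) ^ 2 = 0 := by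
    rw [← Polynomial.map_pow]
    ext j
    rw [coeff_map, coeff_zero, Ideal.Quotient.eq_zero_iff_mem]
    intro β hβ
    have : (((xB ^ 2).coeff j : B) : L) = algebraMap A L (f.coeff j) := by
      rw [← coeff_map, hf, ← hxB, ← map_pow, coe_mapRingHom, coeff_map]; rfl
    rw [this]
    exact hfS j β hβ
  rw [mem_map_range]
  intro i
  have hnil : IsNilpotent (xB.map (Ideal.Quotient.mk 𝔠)) := ⟨2, hsq⟩
  obtain ⟨n, hn⟩ := Polynomial.isNilpotent_iff.mp hnil i
  rw [coeff_map, ← map_pow, Ideal.Quotient.eq_zero_iff_mem] at hn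
  refine hA.mem_range_of_pow hinj n fun k hk => ?_
  obtain ⟨l, rfl⟩ := Nat.exists_eq_add_of_le (show n ≤ k by omega)
  rw [pow_add]
  have := hn (x.coeff i ^ l)
    (pow_mem (show x.coeff i ∈ B from Algebra.subset_adjoin ⟨i, rfl⟩) l)
  rwa [SubmonoidClass.coe_pow, hcoeff] at this

/-- Modulo `p` the `p`-th power is additive, so only monomials matter. -/
theorem exists_coeff_pow_prime {S : Type*} [CommRing S] {p : ℕ} (hp : p.Prime) (x : S[X]) :
    ∀ i, ∃ r, (x ^ p).coeff (i * p) = x.coeff i ^ p + p * r := by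
  induction x using Polynomial.induction_on' with
  | add x y hx hy =>
    intro i
    obtain ⟨r, hr⟩ := hx i
    obtain ⟨s, hs⟩ := hy i
    obtain ⟨q, hq⟩ := exists_add_pow_prime_eq hp x y
    obtain ⟨t, ht⟩ := exists_add_pow_prime_eq hp (x.coeff i) (y.coeff i)
    have h1 : ((p : S[X]) * x * y * q).coeff (i * p) = p * (x * y * q).coeff (i * p) := by
      rw [mul_assoc, mul_assoc, ← mul_assoc x, ← C_eq_natCast, coeff_C_mul]
    refine ⟨r + s + (x * y * q).coeff (i * p) - x.coeff i * y.coeff i * t, ?_⟩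
    rw [hq, coeff_add, coeff_add, h1, hr, hs, coeff_add, ht]
    ring
  | monomial n a =>
    intro i
    refine ⟨0, ?_⟩
    rw [monomial_pow, coeff_monomial, coeff_monomial, mul_zero, add_zero]
    by_cases h : n = i
    · rw [if_pos h, if_pos (by rw [h])]
    · rw [if_neg h, if_neg (fun h' => h (Nat.eq_of_mul_eq_mul_right hp.pos h')),
        zero_pow hp.ne_zero]

theorem eq_of_pow_prime_eq_of_mul_eq {p : ℕ} (hp : p.Prime) {a b : L} (h1 : a ^ p = b ^ p)
    (h2 : (p : L) * a = p * b) : a = b := by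
  obtain ⟨r, hr⟩ := exists_add_pow_prime_eq hp b (a - b)
  rw [add_sub_cancel] at hr
  have h : (a - b) ^ p = 0 := by linear_combination h1 - hr - b * r * h2
  exact sub_eq_zero.mp ((pow_eq_zero_iff hp.ne_zero).mp h)

theorem IsWeaklyNormalRing.mem_range_of_pow_prime [IsFractionRing A L] (hA : IsWeaklyNormalRing A)
    {p : ℕ} (hp : p.Prime) {x : L} (h1 : x ^ p ∈ (algebraMap A L).range)
    (h2 : (p : L) * x ∈ (algebraMap A L).range) : x ∈ (algebraMap A L).range := by
  have hinj := IsFractionRing.injective A L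
  obtain ⟨y, hy⟩ := h1
  obtain ⟨w, hw⟩ := h2
  obtain ⟨⟨z, d⟩, hzd⟩ := IsLocalization.surj (nonZeroDivisors A) x
  obtain ⟨a, rfl, rfl⟩ := hA.exists_pow_mul p hp y z w d d.2
    (hinj (by rw [map_pow, ← hzd, mul_pow, map_mul, map_pow, hy]))
    (hinj (by rw [map_mul, map_mul, ← hzd, hw, map_natCast]; ring))
  rw [map_pow] at hy
  rw [map_mul, map_natCast] at hw
  exact ⟨a, eq_of_pow_prime_eq_of_mul_eq hp hy hw⟩

/-- Let `B` be generated by the coefficients of `x`. Seminormality gives `p B ⊆ A`, so the error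
term `p r` in the coefficient of `x ^ p` of degree `i p` is harmless and `x_i ^ p ∈ A`. -/
theorem IsWeaklyNormalRing.mem_range_map_of_pow_prime [IsFractionRing A L]
    (hA : IsWeaklyNormalRing A) {p : ℕ} (hp : p.Prime) {x : L[X]}
    (h1 : x ^ p ∈ (mapRingHom (algebraMap A L)).range)
    (h2 : (p : L[X]) * x ∈ (mapRingHom (algebraMap A L)).range) :
    x ∈ (mapRingHom (algebraMap A L)).range := by
  have hinj := IsFractionRing.injective A L
  have hint : ∀ i, IsIntegral A (x.coeff i) := by
    rw [← isIntegral_iff_isIntegral_coeff]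
    refine IsIntegral.of_pow (n := p) hp.pos ?_
    obtain ⟨f, hf⟩ := h1
    rw [← hf]
    exact isIntegral_algebraMap
  rw [mem_map_range] at h1 h2
  have h2' : ∀ i, algebraMap A L (p : A) * x.coeff i ∈ (algebraMap A L).range := fun i => by
    have := h2 i
    rwa [← C_eq_natCast, coeff_C_mul, ← map_natCast (algebraMap A L)] at this
  let B := Algebra.adjoin A (Set.range x.coeff)
  have hxB : x ∈ (mapRingHom (algebraMap B L)).range := by
    rw [mem_map_range]
    exact fun n => ⟨⟨x.coeff n, Algebra.subset_adjoin ⟨n, rfl⟩⟩, rfl⟩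
  obtain ⟨xB, hxB⟩ := hxB
  have hcoeff : ∀ n, ((xB.coeff n : B) : L) = x.coeff n := fun n => by
    rw [← hxB, coe_mapRingHom, coeff_map]; rfl
  rw [mem_map_range]
  intro i
  refine hA.mem_range_of_pow_prime hp ?_ ?_
  · obtain ⟨r, hr⟩ := exists_coeff_pow_prime hp xB i
    have h3 : (x ^ p).coeff (i * p) = x.coeff i ^ p + algebraMap A L (p : A) * (r : L) := by
      rw [← hxB, ← map_pow, coe_mapRingHom, coeff_map, hr, map_add, map_pow, coeff_map, map_mul,
        map_natCast, map_natCast]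
      rfl
    rw [eq_sub_of_add_eq h3.symm]
    refine sub_mem (h1 _) (hA.seminormal.mul_mem_range_of_mem_adjoin hinj ?_ ?_ r.2)
    · rintro _ ⟨i, rfl⟩; exact hint i
    · rintro _ ⟨i, rfl⟩; exact h2' i
  · rw [← map_natCast (algebraMap A L)]; exact h2' i

end Polynomial

open Polynomial in
theorem IsSeminormalRing.polynomial {A : Type*} [CommRing A] [IsNoetherianRing A]
    (hA : IsSeminormalRing A) : IsSeminormalRing A[X] := by
  have := hA.reduced
  have : IsReduced (FractionRing A) := isReduced_of_isFractionRing A _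
  have hinj := IsFractionRing.injective A (FractionRing A)
  have hinj' := map_injective _ hinj
  have hK := (isWeaklyNormalRing_polynomial_fractionRing A).seminormal
  have := hK.reduced
  refine ⟨isReduced_of_injective (mapRingHom (algebraMap A (FractionRing A))) hinj',
    fun y z h => ?_⟩
  obtain ⟨x, h2, h3⟩ := hK.exists_sq_cube (y.map (algebraMap A (FractionRing A)))
    (z.map (algebraMap A (FractionRing A)))
    (by rw [← Polynomial.map_pow, h, Polynomial.map_pow])
  obtain ⟨x, rfl⟩ := hA.mem_range_map_of_sq_of_cube hinj (x := x) ⟨y, h2⟩ ⟨z, h3⟩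
  exact ⟨x, hinj' (by rw [h2, Polynomial.map_pow]; rfl),
    hinj' (by rw [h3, Polynomial.map_pow]; rfl)⟩

open Polynomial in
theorem IsWeaklyNormalRing.polynomial {A : Type*} [CommRing A] [IsNoetherianRing A]
    (hA : IsWeaklyNormalRing A) : IsWeaklyNormalRing A[X] := by
  have := hA.seminormal.reduced
  have : IsReduced (FractionRing A) := isReduced_of_isFractionRing A _
  have hinj' := map_injective _ (IsFractionRing.injective A (FractionRing A))
  refine ⟨hA.seminormal.polynomial, fun p hp y z w d hd h1 h2 => ?_⟩
  obtain ⟨x, hxp, hxw⟩ := (isWeaklyNormalRing_polynomial_fractionRing A).exists_pow_mul p hp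
    (y.map (algebraMap A (FractionRing A))) (z.map (algebraMap A (FractionRing A)))
    (w.map (algebraMap A (FractionRing A))) (d.map (algebraMap A (FractionRing A)))
    (map_mem_nonZeroDivisors_of_isFractionRing hd)
    (by rw [← Polynomial.map_pow, h1, Polynomial.map_mul, Polynomial.map_pow])
    (by rw [← Polynomial.map_mul, ← h2, Polynomial.map_mul, Polynomial.map_natCast])
  obtain ⟨x, rfl⟩ := hA.mem_range_map_of_pow_prime hp (x := x) ⟨y, hxp⟩ ⟨w, hxw⟩
  exact ⟨x, hinj' (by rw [hxp, Polynomial.map_pow]; rfl),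
    hinj' (by rw [hxw, Polynomial.map_mul, Polynomial.map_natCast]; rfl)⟩

/-! ### Laurent polynomial extensions -/

section Laurent

open LaurentPolynomial Polynomial

variable {A : Type*} [CommRing A]

theorem LaurentPolynomial.coeff_mul_T (f : A[T;T⁻¹]) (m n : ℤ) :
    (f * T m).coeff n = f.coeff (n - m) := by
  rw [T, AddMonoidAlgebra.coeff_mul_single_eq_coeff_mul (m₂ := n - m), mul_one]
  intro k _
  omega

theorem LaurentPolynomial.coeff_C_mul (a : A) (f : A[T;T⁻¹]) (n : ℤ) :
    (LaurentPolynomial.C a * f).coeff n = a * f.coeff n := by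
  rw [← LaurentPolynomial.smul_eq_C_mul, AddMonoidAlgebra.coeff_smul_apply, smul_eq_mul]

theorem Polynomial.coeff_toLaurent_natCast (f : A[X]) (n : ℕ) :
    (toLaurent f).coeff (n : ℤ) = f.coeff n := by
  rw [coeff_toLaurent]
  exact Finsupp.mapDomain_apply Nat.cast_injective _ _

theorem Polynomial.coeff_toLaurent_of_neg (f : A[X]) {n : ℤ} (hn : n < 0) :
    (toLaurent f).coeff n = 0 := by
  rw [coeff_toLaurent]
  refine Finsupp.mapDomain_of_notMem_range _ _ ?_
  rintro ⟨m, hm⟩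
  have : (m : ℤ) = n := hm
  omega

theorem LaurentPolynomial.exists_toLaurent_eq_mul_T (f : A[T;T⁻¹]) :
    ∃ n : ℕ, ∀ m ≥ n, ∃ f' : A[X], toLaurent f' = f * T m := by
  obtain ⟨n, f', hf⟩ := f.exists_T_pow
  refine ⟨n, fun m hm => ?_⟩
  obtain ⟨k, rfl⟩ := Nat.exists_eq_add_of_le hm
  exact ⟨f' * X ^ k, by
    rw [map_mul, hf, Polynomial.toLaurent_X_pow, mul_T_assoc, Nat.cast_add]⟩

theorem LaurentPolynomial.mul_T_left_cancel {f g : A[T;T⁻¹]} {n : ℤ} (h : f * T n = g * T n) :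
    f = g :=
  (isUnit_T n).mul_right_cancel h

theorem isReduced_laurentPolynomial (h : IsReduced A[X]) : IsReduced A[T;T⁻¹] := by
  refine ⟨fun f ⟨n, hn⟩ => ?_⟩
  obtain ⟨m, f', hf⟩ := f.exists_T_pow
  have : f' ^ n = 0 := toLaurent_injective (by
    rw [map_pow, hf, mul_pow, hn, zero_mul, map_zero])
  have h0 : f' = 0 := IsReduced.eq_zero _ ⟨n, this⟩
  rw [h0, map_zero] at hf
  exact LaurentPolynomial.mul_T_left_cancel (n := m) (by rw [← hf, zero_mul])

theorem IsSeminormalRing.laurentPolynomial (h : IsSeminormalRing A[X]) :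
    IsSeminormalRing A[T;T⁻¹] := by
  refine ⟨isReduced_laurentPolynomial h.reduced, fun y z hyz => ?_⟩
  obtain ⟨n, hn⟩ := y.exists_toLaurent_eq_mul_T
  obtain ⟨m, hm⟩ := z.exists_toLaurent_eq_mul_T
  obtain ⟨y', hy⟩ := hn (2 * (n + m)) (by omega)
  obtain ⟨z', hz⟩ := hm (3 * (n + m)) (by omega)
  obtain ⟨x, rfl, rfl⟩ := h.exists_sq_cube y' z' (toLaurent_injective (by
    rw [map_pow, map_pow, hy, hz, mul_pow, mul_pow, hyz, T_pow, T_pow]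
    congr 2
    push_cast
    ring))
  refine ⟨toLaurent x * T (-((n + m : ℕ) : ℤ)), ?_, ?_⟩
  · apply LaurentPolynomial.mul_T_left_cancel (n := ((2 * (n + m) : ℕ) : ℤ))
    rw [← hy, mul_pow, T_pow, mul_T_assoc, map_pow]
    convert (mul_one _).symm using 2
    rw [← T_zero]; congr 1; push_cast; ring
  · apply LaurentPolynomial.mul_T_left_cancel (n := ((3 * (n + m) : ℕ) : ℤ))
    rw [← hz, mul_pow, T_pow, mul_T_assoc, map_pow]
    convert (mul_one _).symm using 2
    rw [← T_zero]; congr 1; push_cast; ring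

theorem IsWeaklyNormalRing.laurentPolynomial (h : IsWeaklyNormalRing A[X]) :
    IsWeaklyNormalRing A[T;T⁻¹] := by
  refine ⟨h.seminormal.laurentPolynomial, fun p hp y z w d hd h1 h2 => ?_⟩
  obtain ⟨n1, hn1⟩ := y.exists_toLaurent_eq_mul_T
  obtain ⟨n2, hn2⟩ := z.exists_toLaurent_eq_mul_T
  obtain ⟨n3, hn3⟩ := w.exists_toLaurent_eq_mul_T
  obtain ⟨M, hM⟩ := d.exists_toLaurent_eq_mul_T
  -- Shifting `y, z, w, d` by `p N`, `N + M`, `N`, `M` clears negative exponents and keeps both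
  -- equations homogeneous; the solution is shifted back by `N`.
  set N := n1 + n2 + n3 with hN
  obtain ⟨y', hy⟩ := hn1 (p * N) (by
    have := Nat.le_mul_of_pos_left N hp.pos; omega)
  obtain ⟨z', hz⟩ := hn2 (N + M) (by omega)
  obtain ⟨w', hw⟩ := hn3 N (by omega)
  obtain ⟨d', hd'⟩ := hM M le_rfl
  have hdreg : d' ∈ nonZeroDivisors A[X] := by
    rw [mem_nonZeroDivisors_iff_right] at hd ⊢
    intro x hx
    apply toLaurent_injective
    rw [map_zero]
    apply hd
    apply LaurentPolynomial.mul_T_left_cancel (n := (M : ℤ))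
    rw [mul_assoc, ← hd', ← map_mul, hx, map_zero, zero_mul]
  obtain ⟨x, rfl, rfl⟩ := h.exists_pow_mul p hp y' z' w' d' hdreg (toLaurent_injective (by
      rw [map_mul, map_pow, map_pow, hy, hz, hd', mul_pow, mul_pow, h1, T_pow, T_pow,
        mul_mul_mul_comm, ← T_add]
      congr 2
      push_cast
      ring)) (toLaurent_injective (by
      rw [map_mul, map_mul, map_natCast, hz, hw, hd', mul_mul_mul_comm, ← h2, ← T_add, mul_assoc]
      congr 3
      push_cast
      ring))
  refine ⟨toLaurent x * T (-(N : ℤ)), ?_, ?_⟩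
  · apply LaurentPolynomial.mul_T_left_cancel (n := ((p * N : ℕ) : ℤ))
    rw [← hy, mul_pow, T_pow, mul_T_assoc, map_pow]
    convert (mul_one _).symm using 2
    rw [← T_zero]; congr 1; push_cast; ring
  · apply LaurentPolynomial.mul_T_left_cancel (n := (N : ℤ))
    rw [← hw, map_mul, map_natCast, mul_assoc, mul_T_assoc]
    congr 1
    convert (mul_one _).symm using 2
    rw [← T_zero]; congr 1; ring

end Laurent

/-! ### The extended Rees ring and its quotient by `t⁻¹` -/

section ExtendedRees

open LaurentPolynomial Polynomial

variable {A : Type*} [CommRing A] (I : Ideal A)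

/-- The element `t⁻¹` of the extended Rees ring. -/
noncomputable def extendedReesRing.tInv : extendedReesRing I :=
  ⟨T (-1), fun n => by
    rw [T_apply]
    split_ifs with h
    · simp [← h]
    · exact zero_mem _⟩

theorem extendedReesRing.coe_tInv : (extendedReesRing.tInv I : A[T;T⁻¹]) = T (-1) := rfl

theorem extendedReesRing.coe_tInv_pow (n : ℕ) :
    ((extendedReesRing.tInv I ^ n : extendedReesRing I) : A[T;T⁻¹]) = T (-(n : ℤ)) := by
  rw [SubmonoidClass.coe_pow, extendedReesRing.coe_tInv, T_pow]
  congr 1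
  ring

theorem extendedReesRing.single_mem {n : ℤ} {a : A} (ha : a ∈ I ^ n.toNat) :
    (LaurentPolynomial.C a * T n) ∈ extendedReesRing I := by
  intro m
  rw [LaurentPolynomial.coeff_C_mul, T_apply]
  split_ifs with h
  · rw [mul_one, ← h]; exact ha
  · rw [mul_zero]; exact zero_mem _

theorem extendedReesRing.mem_span_tInv {f : extendedReesRing I} :
    f ∈ Ideal.span {extendedReesRing.tInv I} ↔
      ∀ n : ℤ, (f : A[T;T⁻¹]).coeff n ∈ I ^ (n + 1).toNat := by
  rw [Ideal.mem_span_singleton]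
  constructor
  · rintro ⟨h, rfl⟩ n
    rw [MulMemClass.coe_mul, extendedReesRing.coe_tInv, mul_comm, LaurentPolynomial.coeff_mul_T,
      sub_neg_eq_add]
    exact h.2 (n + 1)
  · intro h
    refine ⟨⟨(f : A[T;T⁻¹]) * T 1, fun n => ?_⟩, Subtype.ext ?_⟩
    · rw [LaurentPolynomial.coeff_mul_T]
      simpa using h (n - 1)
    · rw [MulMemClass.coe_mul, extendedReesRing.coe_tInv, mul_comm, mul_T_assoc]
      simp

theorem extendedReesRing.tInv_mem_nonZeroDivisors :
    extendedReesRing.tInv I ∈ nonZeroDivisors (extendedReesRing I) := by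
  rw [mem_nonZeroDivisors_iff_right]
  intro x hx
  have h := congrArg Subtype.val hx
  rw [MulMemClass.coe_mul, extendedReesRing.coe_tInv, ZeroMemClass.coe_zero] at h
  exact Subtype.ext (LaurentPolynomial.mul_T_left_cancel (n := -1) (by
    rw [h, ZeroMemClass.coe_zero, zero_mul]))

/-- The inclusion of the Rees algebra in the extended Rees ring. -/
noncomputable def reesAlgebraToExtended : reesAlgebra I →ₐ[A] extendedReesRing I :=
  (toLaurentAlg.comp (reesAlgebra I).val).codRestrict _ fun f n => by
    change (toLaurent (f : A[X])).coeff n ∈ _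
    rcases lt_or_ge n 0 with hn | hn
    · rw [coeff_toLaurent_of_neg _ hn]; exact zero_mem _
    · obtain ⟨m, rfl⟩ := Int.eq_ofNat_of_zero_le hn
      rw [coeff_toLaurent_natCast]
      exact f.2 m

theorem coe_reesAlgebraToExtended (f : reesAlgebra I) :
    (reesAlgebraToExtended I f : A[T;T⁻¹]) = toLaurent (f : A[X]) := rfl

theorem reesAlgebraToExtended_injective : Function.Injective (reesAlgebraToExtended I) :=
  fun _ _ h => Subtype.ext (toLaurent_injective (congrArg Subtype.val h))

theorem eval₂_tInv_surjective : Function.Surjective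
    (Polynomial.eval₂RingHom (reesAlgebraToExtended I : reesAlgebra I →+* extendedReesRing I)
      (extendedReesRing.tInv I)) := by
  set θ := Polynomial.eval₂RingHom (reesAlgebraToExtended I : reesAlgebra I →+* extendedReesRing I)
      (extendedReesRing.tInv I) with hθ
  have hsingle : ∀ (n : ℤ) (a : A), a ∈ I ^ n.toNat →
      LaurentPolynomial.C a * T n ∈ ((extendedReesRing I).val.toRingHom.comp θ).rangeS := by
    intro n a ha
    rcases lt_or_ge n 0 with hn | hn
    · refine ⟨Polynomial.C (algebraMap A _ a) * X ^ n.natAbs, ?_⟩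
      rw [RingHom.comp_apply, map_mul, map_pow, hθ, coe_eval₂RingHom, Polynomial.eval₂_C, eval₂_X]
      change (((reesAlgebraToExtended I) (algebraMap A _ a) *
        extendedReesRing.tInv I ^ n.natAbs : extendedReesRing I) : A[T;T⁻¹]) = _
      rw [MulMemClass.coe_mul, extendedReesRing.coe_tInv_pow, AlgHom.commutes]
      congr 2
      omega
    · obtain ⟨m, rfl⟩ := Int.eq_ofNat_of_zero_le hn
      refine ⟨Polynomial.C ⟨monomial m a, reesAlgebra.monomial_mem.mpr ha⟩, ?_⟩
      rw [RingHom.comp_apply, hθ, coe_eval₂RingHom, Polynomial.eval₂_C]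
      change toLaurent (monomial m a) = _
      rw [← C_mul_X_pow_eq_monomial, toLaurent_C_mul_X_pow]
  intro f
  have hf : (f : A[T;T⁻¹]) ∈ ((extendedReesRing I).val.toRingHom.comp θ).rangeS := by
    rw [← AddMonoidAlgebra.sum_coeff_single (f : A[T;T⁻¹])]
    refine sum_mem fun n _ => ?_
    rw [LaurentPolynomial.single_eq_C_mul_T]
    exact hsingle n _ (f.2 n)
  obtain ⟨q, hq⟩ := hf
  exact ⟨q, Subtype.ext hq⟩

theorem isNoetherianRing_extendedReesRing [IsNoetherianRing A] :
    IsNoetherianRing (extendedReesRing I) :=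
  isNoetherianRing_of_surjective _ _ _ (eval₂_tInv_surjective I)

theorem mem_map_algebraMap_reesAlgebra {f : reesAlgebra I}
    (h : ∀ n, (f : A[X]).coeff n ∈ I ^ (n + 1)) : f ∈ I.map (algebraMap A (reesAlgebra I)) := by
  have hmon : ∀ (n : ℕ) (a : A), a ∈ I ^ (n + 1) → (monomial n a : A[X]) ∈
      (I.map (algebraMap A (reesAlgebra I))).toAddSubmonoid.map
        (reesAlgebra I).val.toRingHom.toAddMonoidHom := by
    intro n a ha
    rw [pow_succ'] at ha
    induction ha using Submodule.mul_induction_on' with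
    | mem_mul_mem b hb c hc =>
      refine ⟨algebraMap A _ b * ⟨monomial n c, reesAlgebra.monomial_mem.mpr hc⟩,
        Ideal.mul_mem_right _ _ (Ideal.mem_map_of_mem _ hb), ?_⟩
      change Polynomial.C b * monomial n c = _
      rw [C_mul_monomial]
    | add x _ y _ hx hy => rw [map_add]; exact add_mem hx hy
  have hf : (f : A[X]) ∈ (I.map (algebraMap A (reesAlgebra I))).toAddSubmonoid.map
        (reesAlgebra I).val.toRingHom.toAddMonoidHom := by
    rw [(f : A[X]).as_sum_support]
    exact sum_mem fun n _ => hmon n _ (h n)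
  obtain ⟨g, hg, hgf⟩ := hf
  rwa [Subtype.ext (show (g : A[X]) = f from hgf)] at hg

/-- `A[It, t⁻¹] / t⁻¹ A[It, t⁻¹]` is the associated graded ring. -/
noncomputable def quotientTInvEquiv :
    (extendedReesRing I ⧸ Ideal.span {extendedReesRing.tInv I}) ≃+* associatedGradedRing I := by
  let θ : reesAlgebra I →+* extendedReesRing I ⧸ Ideal.span {extendedReesRing.tInv I} :=
    (Ideal.Quotient.mk _).comp (reesAlgebraToExtended I : reesAlgebra I →+* extendedReesRing I)
  have hsurj : Function.Surjective θ := by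
    intro y
    obtain ⟨y, rfl⟩ := Ideal.Quotient.mk_surjective y
    -- As `t⁻¹` becomes zero, only the constant term of a polynomial in `t⁻¹` over the Rees algebra
    -- survives.
    obtain ⟨q, rfl⟩ := eval₂_tInv_surjective I y
    refine ⟨q.coeff 0, ?_⟩
    rw [coe_eval₂RingHom, hom_eval₂, Ideal.Quotient.eq_zero_iff_mem.mpr
      (Ideal.mem_span_singleton_self (extendedReesRing.tInv I)), eval₂_at_zero]
  have hker : RingHom.ker θ = I.map (algebraMap A (reesAlgebra I)) := by
    apply le_antisymm
    · intro f hf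
      have hf' : reesAlgebraToExtended I f ∈ Ideal.span {extendedReesRing.tInv I} :=
        Ideal.Quotient.eq_zero_iff_mem.mp hf
      rw [extendedReesRing.mem_span_tInv] at hf'
      refine mem_map_algebraMap_reesAlgebra I fun n => ?_
      have := hf' n
      rwa [coe_reesAlgebraToExtended, coeff_toLaurent_natCast] at this
    · rw [Ideal.map_le_iff_le_comap]
      intro a ha
      refine Ideal.Quotient.eq_zero_iff_mem.mpr ?_
      rw [extendedReesRing.mem_span_tInv]
      intro n
      change (reesAlgebraToExtended I (algebraMap A _ a) : A[T;T⁻¹]).coeff n ∈ _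
      rw [AlgHom.commutes]
      change (LaurentPolynomial.C a).coeff n ∈ _
      rw [LaurentPolynomial.C_apply]
      split_ifs with h
      · rw [h]; simpa using ha
      · exact zero_mem _
  exact ((Ideal.quotEquivOfEq hker.symm).trans
    (RingHom.quotientKerEquivOfSurjective hsurj)).symm

end ExtendedRees

/-! ### Descent to the base ring and closure of the Rees rings under roots -/

section Main

open LaurentPolynomial Polynomial

variable {A : Type*} [CommRing A] (I : Ideal A)

/-- If `a ∈ I ^ k` is nilpotent, then `a t ^ k` is a nilpotent of the extended Rees ring, so it lies
in the radical ideal `(t⁻¹)`, which means `a ∈ I ^ (k + 1)`. Krull's intersection theorem gives `a =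
0`. -/
theorem isReduced_of_isRadical_span_tInv [IsLocalRing A] [IsNoetherianRing A] (hI : I ≠ ⊤)
    (hred : (Ideal.span {extendedReesRing.tInv I}).IsRadical) : IsReduced A := by
  refine ⟨fun a ⟨n, hn⟩ => ?_⟩
  have key : ∀ k, a ∈ I ^ k := by
    intro k
    induction k with
    | zero => simp
    | succ k ih =>
      let f : extendedReesRing I := ⟨LaurentPolynomial.C a * T k,
        extendedReesRing.single_mem I (by simpa using ih)⟩
      have hf : f ∈ Ideal.span {extendedReesRing.tInv I} := by
        refine hred ⟨n, ?_⟩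
        have : f ^ n = 0 := Subtype.ext (by
          rw [SubmonoidClass.coe_pow, mul_pow, ← map_pow, hn, map_zero, zero_mul]; rfl)
        rw [this]
        exact zero_mem _
      have h := (extendedReesRing.mem_span_tInv I).mp hf k
      rw [LaurentPolynomial.coeff_C_mul, T_apply, if_pos rfl, mul_one] at h
      exact h
  have h : a ∈ (⨅ k : ℕ, I ^ k : Ideal A) := Submodule.mem_iInf _ |>.mpr key
  rwa [Ideal.iInf_pow_eq_bot_of_isLocalRing I hI] at h

/-- The constants are saturated in the extended Rees ring near the locus `t⁻¹ = 0`. -/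
theorem dvd_of_mul_algebraMap_eq [IsLocalRing A] (hI : I ≠ ⊤) {g r : extendedReesRing I}
    (hg : g - 1 ∈ Ideal.span {extendedReesRing.tInv I}) {a e : A}
    (h : g * algebraMap A _ a = r * algebraMap A _ e) : e ∣ a := by
  have h0 := (extendedReesRing.mem_span_tInv I).mp hg 0
  have h1 : ((1 : extendedReesRing I) : A[T;T⁻¹]).coeff 0 = 1 := by
    rw [OneMemClass.coe_one, ← T_zero, T_apply, if_pos rfl]
  rw [AddSubgroupClass.coe_sub, AddMonoidAlgebra.coeff_sub, Finsupp.sub_apply, h1] at h0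
  -- The degree zero part of `g` is congruent to `1` modulo `I`, which lies in the maximal ideal.
  have hunit : IsUnit ((g : A[T;T⁻¹]).coeff 0) := by
    by_contra hu
    have h2 : (g : A[T;T⁻¹]).coeff 0 ∈ IsLocalRing.maximalIdeal A := hu
    have h3 : (1 : A) ∈ IsLocalRing.maximalIdeal A := by
      have h4 := sub_mem h2 (IsLocalRing.le_maximalIdeal hI (by simpa using h0))
      rwa [sub_sub_cancel] at h4
    exact (Ideal.ne_top_iff_one _).mp (IsLocalRing.maximalIdeal.isMaximal A).ne_top h3
  have h4 := congrArg (fun f : extendedReesRing I => (f : A[T;T⁻¹]).coeff 0) h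
  have hC : ∀ c : A, ((algebraMap A (extendedReesRing I) c : extendedReesRing I) : A[T;T⁻¹]) =
      LaurentPolynomial.C c := fun c => rfl
  simp only [MulMemClass.coe_mul, hC] at h4
  rw [mul_comm, LaurentPolynomial.coeff_C_mul, mul_comm (r : A[T;T⁻¹]),
    LaurentPolynomial.coeff_C_mul] at h4
  rw [← hunit.dvd_mul_right, h4]
  exact dvd_mul_right _ _

theorem algebraMap_extendedReesRing_mem_nonZeroDivisors {e : A} (he : e ∈ nonZeroDivisors A) :
    algebraMap A (extendedReesRing I) e ∈ nonZeroDivisors (extendedReesRing I) := by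
  rw [mem_nonZeroDivisors_iff_right] at he ⊢
  intro x hx
  ext n
  have h : (x * algebraMap A (extendedReesRing I) e : A[T;T⁻¹]).coeff n = 0 := by
    rw [← MulMemClass.coe_mul, hx]; rfl
  refine he _ ?_
  rw [mul_comm, ← LaurentPolynomial.coeff_C_mul, mul_comm]
  exact h

/-- An element killing `J = (y) + Ann(y)` lies in `Ann(y) ⊆ J`, so its square is zero. Hence `J` has
zero annihilator, and contains a nonzerodivisor by Noetherianity. -/
theorem exists_mul_add_mem_nonZeroDivisors [IsNoetherianRing A] [IsReduced A] (y : A) :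
    ∃ ρ c : A, c * y = 0 ∧ ρ * y + c ∈ nonZeroDivisors A := by
  by_contra! hcon
  let J : Ideal A := Ideal.span {y} ⊔ Submodule.annihilator (Ideal.span {y})
  have hJ : Disjoint (J : Set A) (nonZeroDivisors A) := by
    rw [Set.disjoint_left]
    intro j hj
    obtain ⟨a, ha, c, hc, rfl⟩ := Submodule.mem_sup.mp hj
    obtain ⟨ρ, rfl⟩ := Ideal.mem_span_singleton'.mp ha
    rw [Submodule.mem_annihilator] at hc
    exact hcon ρ c (hc y (Ideal.mem_span_singleton_self y))
  obtain ⟨-, x, hx, hx0⟩ := SetLike.lt_iff_le_and_exists.mp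
    (Ideal.bot_lt_annihilator_of_disjoint_nonZeroDivisors hJ)
  rw [Submodule.mem_annihilator] at hx
  have hxy : x ∈ J := by
    refine Ideal.mem_sup_right (Submodule.mem_annihilator.mpr fun n hn => ?_)
    exact hx n (Ideal.mem_sup_left hn)
  have h2 := hx x hxy
  exact hx0 (IsReduced.eq_zero x ⟨2, by rw [pow_two]; exact h2⟩)

/-- The element `a / e` of the total ring of fractions of the extended Rees ring. -/
theorem exists_mul_algebraMap_eq {e : A} (he : e ∈ nonZeroDivisors A) (a : A) :
    ∃ s : FractionRing (extendedReesRing I),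
      s * algebraMap _ _ (algebraMap A (extendedReesRing I) e) =
        algebraMap _ _ (algebraMap A (extendedReesRing I) a) :=
  ⟨IsLocalization.mk' _ (algebraMap A (extendedReesRing I) a)
    ⟨_, algebraMap_extendedReesRing_mem_nonZeroDivisors I he⟩, IsLocalization.mk'_spec _ _ _⟩

theorem dvd_of_exists_mul_mem_range [IsLocalRing A] (hI : I ≠ ⊤) {a e : A}
    {s : FractionRing (extendedReesRing I)}
    (hs : s * algebraMap _ _ (algebraMap A (extendedReesRing I) e) =
        algebraMap _ _ (algebraMap A (extendedReesRing I) a))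
    (h : ∃ g : extendedReesRing I, g - 1 ∈ Ideal.span {extendedReesRing.tInv I} ∧
      algebraMap _ (FractionRing (extendedReesRing I)) g * s ∈
        (algebraMap (extendedReesRing I) (FractionRing (extendedReesRing I))).range) : e ∣ a := by
  obtain ⟨g, hg, r, hr⟩ := h
  refine dvd_of_mul_algebraMap_eq I hI (r := r) hg
    (IsFractionRing.injective (extendedReesRing I) (FractionRing (extendedReesRing I)) ?_)
  rw [map_mul, map_mul, ← hs, hr]
  ring

theorem pow_eq_of_mul_algebraMap_eq {a e b : A} (he : e ∈ nonZeroDivisors A)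
    {s : FractionRing (extendedReesRing I)}
    (hs : s * algebraMap _ _ (algebraMap A (extendedReesRing I) e) =
        algebraMap _ _ (algebraMap A (extendedReesRing I) a)) {n : ℕ} (h : a ^ n = b * e ^ n) :
    s ^ n ∈ (algebraMap (extendedReesRing I) (FractionRing (extendedReesRing I))).range := by
  refine ⟨algebraMap A _ b, ?_⟩
  refine ((IsLocalization.map_units (FractionRing (extendedReesRing I))
    ⟨_, algebraMap_extendedReesRing_mem_nonZeroDivisors I he⟩).pow n).mul_right_cancel ?_
  change _ * (algebraMap _ _ (algebraMap A (extendedReesRing I) e)) ^ n =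
    _ * (algebraMap _ _ (algebraMap A (extendedReesRing I) e)) ^ n
  rw [← mul_pow, hs]
  simp only [← map_pow, ← map_mul]
  rw [h]

/-- As `y` may be a zerodivisor, the fraction `z / y` is replaced by `s = ρ z / (ρ y + c)`, where `c
y = 0` and so `c z = 0` by reducedness. Then `s² = y` and `s³ = z`. -/
theorem isSeminormalRing_of_associatedGradedRing [IsLocalRing A] [IsNoetherianRing A] (hI : I ≠ ⊤)
    (hG : IsSeminormalRing (extendedReesRing I ⧸ Ideal.span {extendedReesRing.tInv I})) :
    IsSeminormalRing A := by
  have hA := isReduced_of_isRadical_span_tInv I hI (isRadical_span_of_isReduced_quotient hG.reduced)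
  have := isNoetherianRing_extendedReesRing I
  refine ⟨hA, fun y z h => ?_⟩
  obtain ⟨ρ, c, hcy, he⟩ := exists_mul_add_mem_nonZeroDivisors y
  have hcz : c * z = 0 := IsReduced.eq_zero _ ⟨2, by
    rw [mul_pow, ← h]; linear_combination c * y ^ 2 * hcy⟩
  obtain ⟨s, hs⟩ := exists_mul_algebraMap_eq I he (ρ * z)
  have h2 : (ρ * z) ^ 2 = y * (ρ * y + c) ^ 2 := by
    linear_combination -ρ ^ 2 * h - (2 * ρ * y + c) * hcy
  have h3 : (ρ * z) ^ 3 = z * (ρ * y + c) ^ 3 := by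
    linear_combination -ρ ^ 3 * z * h - (3 * ρ ^ 2 * y ^ 2 + 3 * ρ * y * c + c ^ 2) * hcz
  obtain ⟨x, hx⟩ := dvd_of_exists_mul_mem_range I hI hs
    (exists_mul_mem_range_of_sq_of_cube (extendedReesRing.tInv_mem_nonZeroDivisors I) hG s
      (pow_eq_of_mul_algebraMap_eq I he hs h2) (pow_eq_of_mul_algebraMap_eq I he hs h3))
  rw [hx] at h2 h3
  refine ⟨x, ?_, ?_⟩
  · exact (mul_cancel_right_mem_nonZeroDivisors (pow_mem he 2)).mp (by rw [← h2]; ring)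
  · exact (mul_cancel_right_mem_nonZeroDivisors (pow_mem he 3)).mp (by rw [← h3]; ring)

theorem isWeaklyNormalRing_of_associatedGradedRing [IsLocalRing A] [IsNoetherianRing A]
    (hI : I ≠ ⊤) (hR : IsSeminormalRing (extendedReesRing I))
    (hG : IsWeaklyNormalRing (extendedReesRing I ⧸ Ideal.span {extendedReesRing.tInv I})) :
    IsWeaklyNormalRing A := by
  have := isNoetherianRing_extendedReesRing I
  refine ⟨isSeminormalRing_of_associatedGradedRing I hI hG.seminormal,
    fun p hp y z w d hd h1 h2 => ?_⟩
  obtain ⟨s, hs⟩ := exists_mul_algebraMap_eq I hd z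
  have hps : (p : FractionRing (extendedReesRing I)) * s ∈
      (algebraMap (extendedReesRing I) (FractionRing (extendedReesRing I))).range := by
    refine ⟨algebraMap A _ w, ?_⟩
    refine (IsLocalization.map_units (FractionRing (extendedReesRing I))
      ⟨_, algebraMap_extendedReesRing_mem_nonZeroDivisors I hd⟩).mul_right_cancel ?_
    change _ * (algebraMap _ _ (algebraMap A (extendedReesRing I) d)) =
      _ * (algebraMap _ _ (algebraMap A (extendedReesRing I) d))
    rw [mul_assoc, hs, ← map_mul, ← map_mul, mul_comm w, ← h2, map_mul, map_mul, map_natCast,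
      map_natCast]
  obtain ⟨x, rfl⟩ := dvd_of_exists_mul_mem_range I hI hs
    (exists_mul_mem_range_of_pow_prime (extendedReesRing.tInv_mem_nonZeroDivisors I) hR hG hp s
      (pow_eq_of_mul_algebraMap_eq I hd hs h1) hps)
  refine ⟨x, ?_, ?_⟩
  · exact (mul_cancel_right_mem_nonZeroDivisors (pow_mem hd p)).mp (by rw [← h1]; ring)
  · exact (mul_cancel_left_mem_nonZeroDivisors hd).mp (by rw [← h2]; ring)

theorem extendedReesRing.exists_mul_T_mem (f : A[T;T⁻¹]) :
    ∃ n : ℕ, f * T (-(n : ℤ)) ∈ extendedReesRing I := by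
  refine ⟨(f.coeff.support.sup Int.natAbs), fun n => ?_⟩
  rw [LaurentPolynomial.coeff_mul_T, sub_neg_eq_add]
  rcases le_or_gt n 0 with hn | hn
  · rw [Int.toNat_of_nonpos hn]; simp
  · have : f.coeff (n + (f.coeff.support.sup Int.natAbs : ℕ)) = 0 := by
      by_contra h
      have := Finset.le_sup (f := Int.natAbs) (Finsupp.mem_support_iff.mpr h)
      omega
    rw [this]
    exact zero_mem _

/-- If `f t^-(k+1)` lies in the ring, its `n`-th power is divisible by `t⁻¹`. By radicality so is
the element itself, whence `f t^-k` lies in the ring; descend to `k = 0`. -/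
theorem extendedReesRing.mem_of_pow_mem
    (hred : (Ideal.span {extendedReesRing.tInv I}).IsRadical) {f : A[T;T⁻¹]} {n : ℕ} (hn : n ≠ 0)
    (h : f ^ n ∈ extendedReesRing I) : f ∈ extendedReesRing I := by
  have key : ∀ k : ℕ, f * T (-(k : ℤ)) ∈ extendedReesRing I → f ∈ extendedReesRing I := by
    intro k
    induction k with
    | zero => intro h; simpa using h
    | succ k ih =>
      intro hk
      apply ih
      have hmem : (⟨_, hk⟩ : extendedReesRing I) ∈ Ideal.span {extendedReesRing.tInv I} := by
        refine hred ⟨n, ?_⟩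
        rw [Ideal.mem_span_singleton]
        have h1 : (⟨_, hk⟩ : extendedReesRing I) ^ n =
            extendedReesRing.tInv I ^ ((k + 1) * n) * ⟨f ^ n, h⟩ := by
          apply Subtype.ext
          rw [MulMemClass.coe_mul, extendedReesRing.coe_tInv_pow, SubmonoidClass.coe_pow, mul_pow,
            T_pow, mul_comm]
          congr 2
          push_cast
          ring
        rw [h1]
        exact Dvd.dvd.mul_right (dvd_pow_self _ (Nat.mul_ne_zero (Nat.succ_ne_zero k) hn)) _
      obtain ⟨g, hg⟩ := Ideal.mem_span_singleton.mp hmem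
      have hg' : f * T (-((k + 1 : ℕ) : ℤ)) = T (-1) * (g : A[T;T⁻¹]) := by
        have := congrArg Subtype.val hg
        rwa [MulMemClass.coe_mul, extendedReesRing.coe_tInv] at this
      rw [mul_comm (T (-1) : A[T;T⁻¹])] at hg'
      have : f * T (-(k : ℤ)) = (g : A[T;T⁻¹]) := by
        apply LaurentPolynomial.mul_T_left_cancel (n := -1)
        rw [← hg', mul_T_assoc]
        congr 2
        push_cast
        ring
      rw [this]
      exact g.2
  obtain ⟨k, hk⟩ := extendedReesRing.exists_mul_T_mem I f
  exact key k hk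

theorem extendedReesRing.val_mem_nonZeroDivisors {d : extendedReesRing I}
    (hd : d ∈ nonZeroDivisors (extendedReesRing I)) :
    (d : A[T;T⁻¹]) ∈ nonZeroDivisors A[T;T⁻¹] := by
  rw [mem_nonZeroDivisors_iff_right] at hd ⊢
  intro x hx
  obtain ⟨k, hk⟩ := extendedReesRing.exists_mul_T_mem I x
  have h0 := hd ⟨_, hk⟩ (Subtype.ext (by
    rw [MulMemClass.coe_mul, mul_right_comm, hx, zero_mul]; rfl))
  exact LaurentPolynomial.mul_T_left_cancel (n := -(k : ℤ)) (by
    rw [zero_mul]; exact congrArg Subtype.val h0)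

/-- In a reduced ring a coefficient in the lowest negative degree would survive in the `n`-th power,
so `f` has no negative part. -/
theorem mem_range_reesAlgebraToExtended_of_pow_mem [IsReduced A] {f : extendedReesRing I} {n : ℕ}
    (hn : n ≠ 0)
    (h : f ^ n ∈ (reesAlgebraToExtended I : reesAlgebra I →+* extendedReesRing I).range) :
    f ∈ (reesAlgebraToExtended I : reesAlgebra I →+* extendedReesRing I).range := by
  obtain ⟨g, hg⟩ := h
  have hg' : toLaurent (g : A[X]) = (f : A[T;T⁻¹]) ^ n := congrArg Subtype.val hg
  have key : ∀ k : ℕ, ∀ q : A[X], toLaurent q = (f : A[T;T⁻¹]) * T k →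
      ∃ q : A[X], toLaurent q = (f : A[T;T⁻¹]) := by
    intro k
    induction k with
    | zero => intro q hq; exact ⟨q, by simpa using hq⟩
    | succ k ih =>
      intro q hq
      have h1 : q ^ n = X ^ ((k + 1) * n) * (g : A[X]) := toLaurent_injective (by
        rw [map_pow, map_mul, hq, hg', Polynomial.toLaurent_X_pow, mul_pow, T_pow, mul_comm]
        congr 2
        push_cast
        ring)
      have h2 : q.coeff 0 ^ n = 0 := by
        rw [← Polynomial.constantCoeff_apply, ← map_pow, h1, map_mul, map_pow,
          Polynomial.constantCoeff_apply, coeff_X_zero,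
          zero_pow (Nat.mul_ne_zero (Nat.succ_ne_zero k) hn), zero_mul]
      obtain ⟨q', rfl⟩ := X_dvd_iff.mpr (IsReduced.eq_zero _ ⟨n, h2⟩)
      refine ih q' (LaurentPolynomial.mul_T_left_cancel (n := 1) ?_)
      rw [mul_T_assoc, ← Nat.cast_one, ← Nat.cast_add, ← hq, map_mul, toLaurent_X, mul_comm]
      rfl
  obtain ⟨k, q, hq⟩ := (f : A[T;T⁻¹]).exists_T_pow
  obtain ⟨q, hq⟩ := key k q hq
  refine ⟨⟨q, fun i => ?_⟩, Subtype.ext hq⟩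
  rw [← coeff_toLaurent_natCast, hq]
  exact f.2 i

/-- Let `f d = 0`. For `a ∈ I` and large `N`, `a ^ N t ^ N f` lies in the Rees algebra and kills
`d`, so it vanishes, and `a f = 0` by reducedness. Coefficients of `d` in positive degree lie in
`I`; therefore `f d_0 = 0`, and each coefficient of `f`, taken as a constant, kills `d`. -/
theorem reesAlgebraToExtended_mem_nonZeroDivisors [IsReduced A] {d : reesAlgebra I}
    (hd : d ∈ nonZeroDivisors (reesAlgebra I)) :
    reesAlgebraToExtended I d ∈ nonZeroDivisors (extendedReesRing I) := by
  rw [mem_nonZeroDivisors_iff_right] at hd ⊢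
  intro f hf
  have hf' : (f : A[T;T⁻¹]) * toLaurent (d : A[X]) = 0 := congrArg Subtype.val hf
  have hIf : ∀ a ∈ I, ∀ n, a * (f : A[T;T⁻¹]).coeff n = 0 := by
    intro a ha n
    obtain ⟨N, q, hq⟩ := (f : A[T;T⁻¹]).exists_T_pow
    have hmem : Polynomial.C (a ^ N) * q ∈ reesAlgebra I := by
      intro i
      have h1 : q.coeff i = (f : A[T;T⁻¹]).coeff (i - N) := by
        rw [← coeff_toLaurent_natCast, hq, LaurentPolynomial.coeff_mul_T]
      rw [Polynomial.coeff_C_mul, h1]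
      refine Ideal.pow_le_pow_right (show i ≤ N + ((i : ℤ) - N).toNat by omega) ?_
      rw [pow_add]
      exact Ideal.mul_mem_mul (Ideal.pow_mem_pow ha N) (f.2 _)
    have h2 := hd ⟨_, hmem⟩ (Subtype.ext (toLaurent_injective (by
      rw [MulMemClass.coe_mul, map_mul, map_mul, hq, ZeroMemClass.coe_zero, map_zero]
      linear_combination toLaurent (Polynomial.C (a ^ N)) * T N * hf')))
    have h3 : Polynomial.C (a ^ N) * q = 0 := congrArg Subtype.val h2
    have h4 : LaurentPolynomial.C (a ^ N) * (f : A[T;T⁻¹]) = 0 := by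
      apply LaurentPolynomial.mul_T_left_cancel (n := (N : ℤ))
      rw [mul_assoc, ← hq, ← toLaurent_C, ← map_mul, h3, map_zero, zero_mul]
    have h5 : a ^ N * (f : A[T;T⁻¹]).coeff n = 0 := by
      rw [← LaurentPolynomial.coeff_C_mul, h4]; rfl
    refine IsReduced.eq_zero _ ⟨N + 1, ?_⟩
    rw [mul_pow, pow_succ, pow_succ]
    linear_combination a * (f : A[T;T⁻¹]).coeff n ^ N * h5
  have hmul : ∀ q : A[X], (∀ i, q.coeff i ∈ I) → (f : A[T;T⁻¹]) * toLaurent q = 0 := by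
    intro q hq
    rw [q.as_sum_support_C_mul_X_pow, map_sum, Finset.mul_sum]
    refine Finset.sum_eq_zero fun i _ => ?_
    rw [toLaurent_C_mul_X_pow, mul_left_comm, ← mul_assoc]
    have : LaurentPolynomial.C (q.coeff i) * (f : A[T;T⁻¹]) = 0 := by
      ext n
      rw [LaurentPolynomial.coeff_C_mul, hIf _ (hq i)]; rfl
    rw [this, zero_mul]
  have hpos : ∀ i, i ≠ 0 → (d : A[X]).coeff i ∈ I := fun i hi =>
    Ideal.pow_le_self hi (d.2 i)
  have h0 : (f : A[T;T⁻¹]) * LaurentPolynomial.C ((d : A[X]).coeff 0) = 0 := by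
    have h1 := hmul ((d : A[X]) - Polynomial.C ((d : A[X]).coeff 0)) fun i => by
      rw [Polynomial.coeff_sub, Polynomial.coeff_C]
      split_ifs with h
      · rw [h, sub_self]; exact zero_mem _
      · rw [sub_zero]; exact hpos i h
    rw [map_sub, mul_sub, hf', toLaurent_C, zero_sub, neg_eq_zero] at h1
    exact h1
  ext n
  have h2 := hd (algebraMap A _ ((f : A[T;T⁻¹]).coeff n)) (Subtype.ext (by
    rw [MulMemClass.coe_mul]
    change Polynomial.C _ * (d : A[X]) = 0
    ext i
    rw [Polynomial.coeff_C_mul, Polynomial.coeff_zero]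
    rcases eq_or_ne i 0 with rfl | hi
    · rw [mul_comm, ← LaurentPolynomial.coeff_C_mul, mul_comm, h0]; rfl
    · rw [mul_comm]; exact hIf _ (hpos i hi) n))
  have h3 : Polynomial.C ((f : A[T;T⁻¹]).coeff n) = 0 := congrArg Subtype.val h2
  exact Polynomial.C_eq_zero.mp h3

end Main

theorem mainTheorem1 {A : Type*} [CommRing A] [IsLocalRing A] [IsNoetherianRing A]
    (hdim : 1 ≤ ringKrullDim A) (I : Ideal A) (hI : I ≠ ⊤) :
    (IsSeminormalRing (associatedGradedRing I) →
      IsSeminormalRing (reesAlgebra I) ∧ IsSeminormalRing (extendedReesRing I) ∧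
        IsSeminormalRing A) ∧
    (IsWeaklyNormalRing (associatedGradedRing I) →
      IsWeaklyNormalRing (reesAlgebra I) ∧ IsWeaklyNormalRing (extendedReesRing I) ∧
        IsWeaklyNormalRing A) := by
  have hsat : IsReduced (extendedReesRing I ⧸ Ideal.span {extendedReesRing.tInv I}) →
      ∀ (x : LaurentPolynomial A) (n : ℕ), n ≠ 0 →
        x ^ n ∈ (extendedReesRing I).val.toRingHom.range →
          x ∈ (extendedReesRing I).val.toRingHom.range := by
    rintro hred x n hn ⟨y, hy⟩
    exact ⟨⟨x, extendedReesRing.mem_of_pow_mem I (isRadical_span_of_isReduced_quotient hred) hn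
      (hy ▸ y.2)⟩, rfl⟩
  have key : IsSeminormalRing (associatedGradedRing I) →
      IsSeminormalRing (extendedReesRing I) ∧ IsSeminormalRing A := by
    intro hG
    have hG' : IsSeminormalRing (extendedReesRing I ⧸ Ideal.span {extendedReesRing.tInv I}) :=
      IsSeminormalRing.of_ringEquiv (R := extendedReesRing I ⧸ Ideal.span {extendedReesRing.tInv I})
        hG (quotientTInvEquiv I)
    have hA := isSeminormalRing_of_associatedGradedRing I hI hG'
    exact ⟨hA.polynomial.laurentPolynomial.of_injective (extendedReesRing I).val.toRingHom
      Subtype.val_injective (hsat hG'.reduced), hA⟩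
  refine ⟨fun hG => ?_, fun hG => ?_⟩
  · obtain ⟨hR, hA⟩ := key hG
    have := hA.reduced
    exact ⟨hR.of_injective _ (reesAlgebraToExtended_injective I)
      fun f n hn h => mem_range_reesAlgebraToExtended_of_pow_mem I hn h, hR, hA⟩
  · have hG' : IsWeaklyNormalRing (extendedReesRing I ⧸ Ideal.span {extendedReesRing.tInv I}) :=
      IsWeaklyNormalRing.of_ringEquiv
        (R := extendedReesRing I ⧸ Ideal.span {extendedReesRing.tInv I}) hG (quotientTInvEquiv I)
    -- The seminormal case supplies seminormality of the extended Rees ring, which the deformation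
    -- of weak normality requires.
    have hA := isWeaklyNormalRing_of_associatedGradedRing I hI (key hG.seminormal).1 hG'
    have := hA.seminormal.reduced
    have hR : IsWeaklyNormalRing (extendedReesRing I) :=
      hA.polynomial.laurentPolynomial.of_injective (extendedReesRing I).val.toRingHom
        Subtype.val_injective (hsat hG'.seminormal.reduced)
        fun d hd => extendedReesRing.val_mem_nonZeroDivisors I hd
    exact ⟨hR.of_injective _ (reesAlgebraToExtended_injective I)
      (fun f n hn h => mem_range_reesAlgebraToExtended_of_pow_mem I hn h)
      fun d hd => reesAlgebraToExtended_mem_nonZeroDivisors I hd, hR, hA⟩
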